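/- **Setting.** A seller of $n$ items faces one buyer whose valuation $v:2^{[n]}\to\mathbb R_{\ge 0}$ is drawn from a known prior $D$; the buyer is risk-neutral (utility $=$ expected value $-$ expected payment). A *direct mechanism* $M$ assigns to each type (valuation in the support of $D$) a lottery over bundles and an expected payment $\ge 0$. It is IC if truthful reporting maximizes the expected utility of each type, IR if truthful utilities are $\ge 0$, and *optimal* if it is IC and IR and its expected revenue equals the supremum $\mathrm{OPT}(D)$ of the expected revenue over all IC and IR direct mechanisms. An *auction protocol* is a (possibly infinite) binary tree whose internal nodes are either buyer nodes or chance nodes (with a distribution on the two children) and whose leaves carry a bundle and a payment $\ge 0$, together with a suggested buyer strategy (a choice of child at each buyer node) for each type. For $\varepsilon\ge 0$ it is *$\varepsilon$-IC* if it terminates with probability $1$ under every buyer strategy, the buyer has a strategy guaranteeing expected payment $0$ and the empty bundle, and for each type no strategy has expected utility exceeding that of the suggested strategy by more than $\varepsilon$; *IC* means $0$-IC. A protocol (IC or not) *implements* $M$ if, for each type, following the suggested strategy yields the lottery over bundles and the expected payment prescribed by $M$. Communication is the depth of the leaf reached (bits of the buyer and of chance); *worst-case* is over all buyer strategies and chance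 outcomes; *ex ante expected* is the average over $v\sim D$ and over chance under the suggested strategies (hence a lower bound on it also bounds the expected communication of a worst-case strategy). **Statement.** For every constant $\tau>0$ there are constants $b,n_0\in\mathbb N$, $\varepsilon,\kappa>0$ and $C$, depending only on $\tau$, such that for every $n\ge n_0$ there are $k\ge 1$, a nonempty family $X$ of $k$-element subsets of $[n]$ and values $c(x)>0$ for $x\in X$ with the following properties. Let $D$ be the prior that draws $x\in X$ uniformly and gives the buyer the valuation $v_c^x$ with $v_c^x(S)=c(x)$ if $S\cap x\ne\emptyset$ and $v_c^x(S)=0$ otherwise. 1. Each valuation in the support of $D$ is unit-demand, i.e. of the form $v(S)=\max_{i\in S}v_i$ (with value $0$ for $S=\emptyset$), and has constant precision: every bundle has a value in $\{m/2^b: m=0,1,\dots,2^b\}$. 2. The mechanism $M$ that gives the type $v_c^x$ a uniformly random item of $x$ and charges $c(x)$ is optimal for $D$. 3. $M$ is implemented by an (exactly) IC auction protocol with worst-case communication at most $C n$. 4. $M$ is implemented by a randomized auction protocol, not required to be IC, with worst-case communication at most $C\log n$. 5. Every $\varepsilon$-IC auction protocol whose expected revenue under the suggested strategies is at least $\tau\cdot\mathrm{OPT}(D)$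 has ex ante expected communication at least $\kappa n$. In particular, every $\varepsilon$-IC implementation of $M$ has ex ante expected communication at least $\kappa n$ when $\tau\le 1$, whereas $O(\log n)$ bits are enough in the worst case if incentives are ignored: an exponential separation between implementing and incentivizing. -/

import Mathlib

open scoped NNReal ENNReal

noncomputable section

/-- A valuation of the buyer: a nonnegative value for every bundle of the `n` items. -/
abbrev BundleValuation (n : ℕ) : Type := Finset (Fin n) → ℝ≥0

/-- Unit demand: the value of a bundle is the maximum of its item values (`0` for the empty bundle). -/
def IsUnitDemand {n : ℕ} (v : BundleValuation n) : Prop :=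
  ∃ u : Fin n → ℝ≥0, ∀ S : Finset (Fin n), v S = S.sup u

/-- Every bundle has a value in `[0, 1]` that is an integer multiple of `2 ^ (-b)`, so that
`b` bits after the binary point are enough to write it. -/
def HasPrecision {n : ℕ} (b : ℕ) (v : BundleValuation n) : Prop :=
  ∀ S : Finset (Fin n), ∃ m : ℕ, m ≤ 2 ^ b ∧ v S = (m : ℝ≥0) / 2 ^ b

/-! ### Direct revelation mechanisms -/

/-- A direct revelation mechanism: for each reported type, a lottery over bundles and an expected
(nonnegative) payment. -/
structure DirectMechanism (n : ℕ) where
  alloc : BundleValuation n → PMF (Finset (Fin n))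
  pay : BundleValuation n → ℝ≥0

/-- Expected value of a lottery over bundles for a buyer with valuation `v`. -/
def lotteryValue {n : ℕ} (v : BundleValuation n) (L : PMF (Finset (Fin n))) : ℝ≥0∞ :=
  ∑ S : Finset (Fin n), L S * (v S : ℝ≥0∞)

namespace DirectMechanism

variable {n : ℕ}

/-- Truthful in expectation: `value - payment` of the true report is at least that of any other
report (the inequality is written without subtraction). -/
def IsIC (D : PMF (BundleValuation n)) (M : DirectMechanism n) : Prop :=
  ∀ v ∈ D.support, ∀ v' ∈ D.support,
    lotteryValue v (M.alloc v') + M.pay v ≤ lotteryValue v (M.alloc v) + M.pay v'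

/-- Interim individual rationality. -/
def IsIR (D : PMF (BundleValuation n)) (M : DirectMechanism n) : Prop :=
  ∀ v ∈ D.support, (M.pay v : ℝ≥0∞) ≤ lotteryValue v (M.alloc v)

/-- Expected revenue when all types report truthfully. -/
def revenue (D : PMF (BundleValuation n)) (M : DirectMechanism n) : ℝ≥0∞ :=
  ∑' v, D v * (M.pay v : ℝ≥0∞)

end DirectMechanism

/-- The optimal revenue for the prior `D`: the supremum over all IC and IR mechanisms. -/
def optRevenue {n : ℕ} (D : PMF (BundleValuation n)) : ℝ≥0∞ :=
  ⨆ (M : DirectMechanism n) (_ : M.IsIC D ∧ M.IsIR D), M.revenue D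

/-- `M` is a revenue-optimal IC and IR mechanism for the prior `D`. -/
def DirectMechanism.IsOptimal {n : ℕ} (D : PMF (BundleValuation n)) (M : DirectMechanism n) : Prop :=
  M.IsIC D ∧ M.IsIR D ∧ M.revenue D = optRevenue D

/-! ### Auction protocols -/

/-- Label of a node of a protocol tree: a node of the buyer, a node of chance with a distribution
on its two children, or a leaf with an allocation and a payment. -/
inductive NodeLabel (n : ℕ) : Type
  | buyer : NodeLabel n
  | chance (μ : PMF Bool) : NodeLabel n
  | leaf (S : Finset (Fin n)) (q : ℝ≥0) : NodeLabel n

/-- A possibly infinite binary tree. A node is addressed by the list of bits on the path from the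
root `[]`, the latest bit first: the children of `a` are `false :: a` and `true :: a`. Labels of
addresses below a leaf are irrelevant, since they are never reached. -/
abbrev ProtocolTree (n : ℕ) : Type := List Bool → NodeLabel n

/-- A strategy of the buyer chooses a child at each node of the buyer (its values at the other
nodes are irrelevant). -/
abbrev Strategy : Type := List Bool → Bool

namespace ProtocolTree

variable {n : ℕ}

/-- The probability that the play goes on from node `a` to its child `b :: a`. -/
def stepProb (T : ProtocolTree n) (s : Strategy) (a : List Bool) (b : Bool) : ℝ≥0∞ :=
  match T a with
  | NodeLabel.buyer => if s a = b then 1 else 0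
  | NodeLabel.chance μ => μ b
  | NodeLabel.leaf _ _ => 0

/-- The probability that a node is reached when the buyer plays `s`. -/
def reach (T : ProtocolTree n) (s : Strategy) : List Bool → ℝ≥0∞
  | [] => 1
  | b :: a => reach T s a * stepProb T s a b

/-- The expectation of `f depth allocation payment` at the leaf that is reached
(a play that never ends contributes `0`). -/
def leafExp (T : ProtocolTree n) (s : Strategy)
    (f : ℕ → Finset (Fin n) → ℝ≥0 → ℝ≥0∞) : ℝ≥0∞ :=
  ∑' a : List Bool,
    match T a with
    | NodeLabel.leaf S q => reach T s a * f a.length S q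
    | _ => 0

/-- The probability that the protocol terminates. -/
def terminationProb (T : ProtocolTree n) (s : Strategy) : ℝ≥0∞ :=
  T.leafExp s fun _ _ _ => 1

/-- The probability that the buyer is allocated exactly the bundle `S`. -/
def allocProb (T : ProtocolTree n) (s : Strategy) (S : Finset (Fin n)) : ℝ≥0∞ :=
  T.leafExp s fun _ S' _ => if S' = S then 1 else 0

/-- Expected payment. -/
def expPay (T : ProtocolTree n) (s : Strategy) : ℝ≥0∞ :=
  T.leafExp s fun _ _ q => (q : ℝ≥0∞)

/-- Expected value of the allocation for a buyer with valuation `v`. -/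
def expValue (T : ProtocolTree n) (s : Strategy) (v : BundleValuation n) : ℝ≥0∞ :=
  T.leafExp s fun _ S _ => (v S : ℝ≥0∞)

/-- Expected number of bits communicated: the expected depth of the leaf that is reached. -/
def expDepth (T : ProtocolTree n) (s : Strategy) : ℝ≥0∞ :=
  T.leafExp s fun d _ _ => (d : ℝ≥0∞)

/-- Whatever the buyer plays, the protocol terminates with probability one. -/
def IsFinite (T : ProtocolTree n) : Prop :=
  ∀ s : Strategy, T.terminationProb s = 1

/-- The buyer has a strategy that guarantees expected payment `0` and the empty allocation. -/
def IsIR (T : ProtocolTree n) : Prop :=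
  ∃ s : Strategy, T.expPay s = 0 ∧ T.allocProb s ∅ = 1

/-- The protocol uses at most `d` bits in the worst case over strategies and chance. -/
def WorstCaseCommLE (T : ProtocolTree n) (d : ℝ) : Prop :=
  ∀ (s : Strategy) (a : List Bool), T.reach s a ≠ 0 → (a.length : ℝ) ≤ d

end ProtocolTree

/-- An auction protocol: a protocol tree with a suggested strategy for each type. -/
structure AuctionProtocol (n : ℕ) where
  tree : ProtocolTree n
  suggested : BundleValuation n → Strategy

namespace AuctionProtocol

variable {n : ℕ}

/-- `ε`-incentive compatible (in expectation): finite, individually rational, and for each type in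
the support of the prior no strategy has a `value - payment` that exceeds that of the suggested
strategy by more than `ε` (the inequality is written without subtraction). -/
def IsApproxIC (D : PMF (BundleValuation n)) (ε : ℝ≥0) (P : AuctionProtocol n) : Prop :=
  P.tree.IsFinite ∧ P.tree.IsIR ∧
    ∀ v ∈ D.support, ∀ s : Strategy,
      P.tree.expValue s v + P.tree.expPay (P.suggested v) ≤
        P.tree.expValue (P.suggested v) v + P.tree.expPay s + ε

/-- Incentive compatible (in expectation). -/
def IsIC (D : PMF (BundleValuation n)) (P : AuctionProtocol n) : Prop :=
  P.IsApproxIC D 0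

/-- When the buyer follows the suggested strategy, his lottery over bundles and his expected
payment are those of the mechanism `M`. Nothing is said about incentives. -/
def Implements (D : PMF (BundleValuation n)) (P : AuctionProtocol n) (M : DirectMechanism n) : Prop :=
  ∀ v ∈ D.support,
    (∀ S : Finset (Fin n), P.tree.allocProb (P.suggested v) S = M.alloc v S) ∧
      P.tree.expPay (P.suggested v) = M.pay v

/-- Expected revenue when all types follow the suggested strategy. -/
def revenue (D : PMF (BundleValuation n)) (P : AuctionProtocol n) : ℝ≥0∞ :=
  ∑' v, D v * P.tree.expPay (P.suggested v)

/-- Ex ante expected communication: the average over types drawn from the prior and over chance,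
when all types follow the suggested strategy. -/
def exAnteComm (D : PMF (BundleValuation n)) (P : AuctionProtocol n) : ℝ≥0∞ :=
  ∑' v, D v * P.tree.expDepth (P.suggested v)

end AuctionProtocol

/-! ### The hard instances -/

/-- The buyer wants one item of `x`, no matter which, and values it at `r`. -/
def hardValuation {n : ℕ} (x : Finset (Fin n)) (r : ℝ≥0) : BundleValuation n :=
  fun S => if x ∩ S = ∅ then 0 else r

/-- The prior that draws `x` uniformly from `X` and gives the buyer the valuation
`hardValuation x (c x)`. -/
def hardPrior {n : ℕ} (X : Finset (Finset (Fin n))) (hX : X.Nonempty)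
    (c : Finset (Fin n) → ℝ≥0) : PMF (BundleValuation n) :=
  (PMF.uniformOfFinset X hX).map fun x => hardValuation x (c x)

/-- The items that a buyer values. -/
def wantedItems {n : ℕ} (v : BundleValuation n) : Finset (Fin n) :=
  {i | v {i} ≠ 0}

open Classical in
/-- The mechanism that allocates one uniformly random item among those that the buyer wants and
charges his value for receiving everything (for the type `hardValuation x r` with `x` nonempty and
`r > 0`: a uniformly random item of `x`, at price `r`). -/
def randomWantedItem (n : ℕ) : DirectMechanism n where
  alloc v :=
    if h : (wantedItems v).Nonempty then
      (PMF.uniformOfFinset (wantedItems v) h).map fun i => {i}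
    else PMF.pure ∅
  pay v := v Finset.univ

end

/-! All that matters about a protocol for incentives is which utilities it offers. Subtract from the
best utility of the type `(x, r)` the utility `-p` that comes from the least expected payment `p`
alone; what remains is a surplus `h x r ≤ r`. It obeys a recursion on the tree: a leaf offers the
value of its bundle, a chance node mixes the surpluses of its children, and a buyer node takes a
maximum after subtracting the difference `t` of the least payments (`IsSurplus`,
`exists_hasSurplus`). Truncated at depth `d`, the possible surplus functions have a finite net of
size about `(M * 2 ^ n) ^ (2 ^ d)` (`exists_surplus_net`): doubly exponential in `d`, but no more.

Surplus bounds revenue. If type `(x, r)` pays `P` under a near-optimal strategy, then type `(x, 2r)`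
can copy that strategy and get the value twice for one payment, so `P ≤ h x (2r) - 2 * h x r` up to
`ε` and a truncation error, which is at most expected depth over `d` by Markov
(`exists_surplus_bound`).

Draw the values `c x = 2 ^ (-j)`, `0 ≤ j ≤ b`, independently with probability `2 ^ j / W`. For any
fixed `h` the expectation of `h x (2 c) - 2 * h x c` telescopes to at most `2 / W`
(`sum_two_pow_mul_surplus_le`), while the expected value is `(b + 1) / W`. A Chernoff bound and a
union bound over the net give one `c` that works for all surplus functions of depth `m = Θ(n)`,
because the family `X` has at least `4 ^ m` members while the logarithm of the net size is only `2 ^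
m` times a polynomial (`exists_values`, `net_card_lt_exp`). A protocol with little communication
then earns at most `3 / W` on average, less than `τ` times the optimum as soon as `τ * b > 3`.

The sets of `X` meet pairwise in at most a `2 ^ (-b)` fraction (`exists_set_family`), so pretending
to be another type never pays, and charging every type its full value is IC and optimal. Announcing
`x` takes `O(n)` bits; without incentives it is enough that chance draws an index and the buyer
names the corresponding item and a price. -/

/-! ### Recursion of leaf expectations at the root of a tree. -/

namespace ProtocolTree

variable {n : ℕ}

/-- The subtree rooted at the child `b` of the root. -/
def sub (T : ProtocolTree n) (b : Bool) : ProtocolTree n := fun a => T (a ++ [b])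

/-- The restriction of a strategy to the subtree rooted at the child `b` of the root. -/
def _root_.Strategy.sub (s : Strategy) (b : Bool) : Strategy := fun a => s (a ++ [b])

/-- The strategy that plays `c` at the root and `σ b` in the subtree of the child `b`. -/
def _root_.Strategy.glue (c : Bool) (σ : Bool → Strategy) : Strategy := fun a =>
  if h : a = [] then c else σ (a.getLast h) a.dropLast

/-- The tree with root label `L` and subtrees `F`. -/
def node (L : NodeLabel n) (F : Bool → ProtocolTree n) : ProtocolTree n := fun a =>
  if h : a = [] then L else F (a.getLast h) a.dropLast

@[simp] theorem _root_.Strategy.sub_glue (c : Bool) (σ : Bool → Strategy) (b : Bool) :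
    (Strategy.glue c σ).sub b = σ b := by
  funext a
  simp [Strategy.sub, Strategy.glue]

@[simp] theorem _root_.Strategy.glue_nil (c : Bool) (σ : Bool → Strategy) :
    Strategy.glue c σ [] = c := by
  simp [Strategy.glue]

@[simp] theorem sub_node (L : NodeLabel n) (F : Bool → ProtocolTree n) (b : Bool) :
    (node L F).sub b = F b := by
  funext a
  simp [sub, node]

@[simp] theorem node_nil (L : NodeLabel n) (F : Bool → ProtocolTree n) : node L F [] = L := by
  simp [node]

/-- The recursion of `reach` removes the last step of a path. Induction over trees needs the first
step removed, which is the last entry of the address. -/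
theorem reach_append (T : ProtocolTree n) (s : Strategy) (b : Bool) (a : List Bool) :
    T.reach s (a ++ [b]) = T.stepProb s [] b * (T.sub b).reach (s.sub b) a := by
  induction a with
  | nil => simp [reach]
  | cons c a ih =>
    simp only [List.cons_append, reach, ih, mul_assoc]
    rfl

theorem tsum_list_bool (g : List Bool → ℝ≥0∞) :
    ∑' a, g a = g [] + (∑' a, g (a ++ [false]) + ∑' a, g (a ++ [true])) := by
  let e : Unit ⊕ Bool × List Bool → List Bool := Sum.elim (fun _ => []) fun p => p.2 ++ [p.1]
  have he : Function.Bijective e := by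
    constructor
    · rintro (_ | ⟨b, a⟩) (_ | ⟨b', a'⟩) h
      · rfl
      · simp [e] at h
      · simp [e] at h
      · simp only [e, Sum.elim_inr] at h
        obtain ⟨h1, h2⟩ := List.append_inj' h rfl
        simp_all
    · intro a
      rcases List.eq_nil_or_concat a with rfl | ⟨l, b, rfl⟩
      · exact ⟨Sum.inl (), rfl⟩
      · exact ⟨Sum.inr (b, l), by simp [e]⟩
  rw [← (Equiv.ofBijective e he).tsum_eq g, ENNReal.summable.tsum_sum ENNReal.summable]
  have h : ∑' p : Bool × List Bool, g (p.2 ++ [p.1]) =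
      ∑' a, g (a ++ [false]) + ∑' a, g (a ++ [true]) := by
    rw [ENNReal.tsum_prod (f := fun b a => g (a ++ [b])), tsum_bool]
  rw [← h]
  simp [e]

/-- The value of `g` at the allocation and payment of a leaf, and `0` at the other nodes. -/
def _root_.NodeLabel.onLeaf (L : NodeLabel n) (g : Finset (Fin n) → ℝ≥0 → ℝ≥0∞) : ℝ≥0∞ :=
  match L with
  | NodeLabel.leaf S q => g S q
  | _ => 0

theorem _root_.NodeLabel.mul_onLeaf (L : NodeLabel n) (c : ℝ≥0∞)
    (g : Finset (Fin n) → ℝ≥0 → ℝ≥0∞) : c * L.onLeaf g = L.onLeaf fun S q => c * g S q := by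
  cases L <;> simp [NodeLabel.onLeaf]

theorem leafExp_def (T : ProtocolTree n) (s : Strategy)
    (f : ℕ → Finset (Fin n) → ℝ≥0 → ℝ≥0∞) :
    T.leafExp s f = ∑' a, (T a).onLeaf fun S q => T.reach s a * f a.length S q :=
  tsum_congr fun a => by cases T a <;> rfl

theorem leafExp_eq (T : ProtocolTree n) (s : Strategy)
    (f : ℕ → Finset (Fin n) → ℝ≥0 → ℝ≥0∞) :
    T.leafExp s f = (T []).onLeaf (f 0) +
      (T.stepProb s [] false * (T.sub false).leafExp (s.sub false) (fun d => f (d + 1)) +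
        T.stepProb s [] true * (T.sub true).leafExp (s.sub true) (fun d => f (d + 1))) := by
  simp only [leafExp_def]
  rw [tsum_list_bool]
  simp only [← ENNReal.tsum_mul_left, NodeLabel.mul_onLeaf, reach_append, List.length_append,
    List.length_singleton, sub, mul_assoc, reach, one_mul, List.length_nil]

theorem leafExp_of_leaf {T : ProtocolTree n} {S : Finset (Fin n)} {q : ℝ≥0}
    (h : T [] = NodeLabel.leaf S q) (s : Strategy) (f : ℕ → Finset (Fin n) → ℝ≥0 → ℝ≥0∞) :
    T.leafExp s f = f 0 S q := by
  rw [leafExp_eq]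
  simp [stepProb, NodeLabel.onLeaf, h]

theorem leafExp_of_buyer {T : ProtocolTree n} (h : T [] = NodeLabel.buyer) (s : Strategy)
    (f : ℕ → Finset (Fin n) → ℝ≥0 → ℝ≥0∞) :
    T.leafExp s f = (T.sub (s [])).leafExp (s.sub (s [])) (fun d => f (d + 1)) := by
  rw [leafExp_eq]
  cases hs : s [] <;> simp [stepProb, NodeLabel.onLeaf, h, hs]

theorem leafExp_of_chance {T : ProtocolTree n} {μ : PMF Bool} (h : T [] = NodeLabel.chance μ)
    (s : Strategy) (f : ℕ → Finset (Fin n) → ℝ≥0 → ℝ≥0∞) :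
    T.leafExp s f =
      μ false * (T.sub false).leafExp (s.sub false) (fun d => f (d + 1)) +
        μ true * (T.sub true).leafExp (s.sub true) (fun d => f (d + 1)) := by
  rw [leafExp_eq]
  simp [stepProb, NodeLabel.onLeaf, h]

theorem leafExp_mono (T : ProtocolTree n) (s : Strategy)
    {f g : ℕ → Finset (Fin n) → ℝ≥0 → ℝ≥0∞} (h : ∀ d S q, f d S q ≤ g d S q) :
    T.leafExp s f ≤ T.leafExp s g := by
  refine ENNReal.tsum_le_tsum fun a => ?_
  cases T a <;> simp only [le_refl]
  gcongr
  apply h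

theorem leafExp_add (T : ProtocolTree n) (s : Strategy)
    (f g : ℕ → Finset (Fin n) → ℝ≥0 → ℝ≥0∞) :
    T.leafExp s (fun d S q => f d S q + g d S q) = T.leafExp s f + T.leafExp s g := by
  simp only [leafExp]
  rw [← ENNReal.tsum_add]
  refine tsum_congr fun a => ?_
  cases T a <;> simp [mul_add]

theorem leafExp_const_mul (T : ProtocolTree n) (s : Strategy) (c : ℝ≥0∞)
    (f : ℕ → Finset (Fin n) → ℝ≥0 → ℝ≥0∞) :
    T.leafExp s (fun d S q => c * f d S q) = c * T.leafExp s f := by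
  simp only [leafExp]
  rw [← ENNReal.tsum_mul_left]
  refine tsum_congr fun a => ?_
  cases T a <;> simp [mul_left_comm]

end ProtocolTree

/-! ### Surplus functions of protocol trees. -/

/-- The surplus functions that trees of depth `d` can offer, as functions of the wanted set `x`
and the value `r`, after subtraction of the least expected payment. -/
inductive IsSurplus {n : ℕ} : ℕ → (Finset (Fin n) → ℝ≥0 → ℝ≥0) → Prop
  | leaf (d : ℕ) (S : Finset (Fin n)) : IsSurplus d fun x r => hardValuation x r S
  | buyer {d : ℕ} {h₀ h₁ : Finset (Fin n) → ℝ≥0 → ℝ≥0} (t : ℝ≥0) :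
      IsSurplus d h₀ → IsSurplus d h₁ → IsSurplus (d + 1) fun x r => max (h₀ x r) (h₁ x r - t)
  | chance {d : ℕ} {h₀ h₁ : Finset (Fin n) → ℝ≥0 → ℝ≥0} (p₀ p₁ : ℝ≥0) (hp : p₀ + p₁ = 1) :
      IsSurplus d h₀ → IsSurplus d h₁ → IsSurplus (d + 1) fun x r => p₀ * h₀ x r + p₁ * h₁ x r

theorem hardValuation_le {n : ℕ} (x : Finset (Fin n)) (r : ℝ≥0) (S : Finset (Fin n)) :
    hardValuation x r S ≤ r := by
  unfold hardValuation
  split_ifs <;> simp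

theorem hardValuation_eq_mul {n : ℕ} (x : Finset (Fin n)) (r : ℝ≥0) (S : Finset (Fin n)) :
    hardValuation x r S = r * hardValuation x 1 S := by
  unfold hardValuation
  split_ifs <;> simp

theorem IsSurplus.le {n d : ℕ} {h : Finset (Fin n) → ℝ≥0 → ℝ≥0} (hh : IsSurplus d h)
    (x : Finset (Fin n)) (r : ℝ≥0) : h x r ≤ r := by
  induction hh with
  | leaf d S => exact hardValuation_le x r S
  | buyer t _ _ ih₀ ih₁ => exact max_le ih₀ (tsub_le_self.trans ih₁)
  | chance p₀ p₁ hp _ _ ih₀ ih₁ =>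
    calc _ ≤ p₀ * r + p₁ * r := add_le_add (mul_le_mul_right ih₀ p₀) (mul_le_mul_right ih₁ p₁)
      _ = r := by rw [← add_mul, hp, one_mul]

namespace ProtocolTree

variable {n : ℕ}

/-- Expected value of the allocation, where leaves of depth at least `d` count as worthless. -/
noncomputable def truncValue (d : ℕ) (T : ProtocolTree n) (s : Strategy) (v : BundleValuation n) : ℝ≥0∞ :=
  T.leafExp s fun d' S _ => if d' < d then (v S : ℝ≥0∞) else 0

theorem truncValue_zero (T : ProtocolTree n) (s : Strategy) (v : BundleValuation n) :
    T.truncValue 0 s v = 0 := by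
  rw [truncValue, leafExp, ENNReal.tsum_eq_zero]
  intro a
  cases T a <;> simp

/-- Homogeneity in the value is what lets a type of value `2 * r` profit twice from the strategy of
the type of value `r`. -/
theorem truncValue_hardValuation (d : ℕ) (T : ProtocolTree n) (s : Strategy)
    (x : Finset (Fin n)) (c r : ℝ≥0) :
    T.truncValue d s (hardValuation x (c * r)) = c * T.truncValue d s (hardValuation x r) := by
  rw [truncValue, truncValue, ← leafExp_const_mul]
  congr 1
  funext d' S _
  rw [hardValuation_eq_mul, hardValuation_eq_mul x r]
  split_ifs <;> simp [mul_assoc]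

/-- Markov's inequality: the truncation loses at most the probability of depth at least `d`,
pointwise because `1 ≤ d' / d` there. -/
theorem expValue_le_truncValue_add {d : ℕ} (hd : d ≠ 0) (T : ProtocolTree n) (s : Strategy)
    (v : BundleValuation n) (hv : ∀ S, v S ≤ 1) :
    T.expValue s v ≤ T.truncValue d s v + T.expDepth s / d := by
  rw [expValue, truncValue, expDepth, ENNReal.div_eq_inv_mul, ← leafExp_const_mul, ← leafExp_add]
  refine leafExp_mono T s fun d' S q => ?_
  split_ifs with h
  · exact le_self_add
  · rw [zero_add, ← ENNReal.div_eq_inv_mul]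
    calc (v S : ℝ≥0∞) ≤ 1 := by exact_mod_cast hv S
      _ = d / d := (ENNReal.div_self (by simpa using hd) (by simp)).symm
      _ ≤ d' / d := by
        gcongr
        omega

/-- `p` is the least expected payment, and `h` is the surplus over the utility `-p` that buyers can
gain, up to contributions from leaves of depth at least `d`. -/
def HasSurplus (d : ℕ) (T : ProtocolTree n) (p : ℝ≥0∞)
    (h : Finset (Fin n) → ℝ≥0 → ℝ≥0) : Prop :=
  (∀ x r (δ : ℝ≥0∞), δ ≠ 0 →
    ∃ s, T.expPay s + h x r ≤ T.expValue s (hardValuation x r) + p + δ) ∧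
  ∀ s x r, T.truncValue d s (hardValuation x r) + p ≤ h x r + T.expPay s

/-- If the least payment is infinite, all strategies pay infinitely much and both inequalities are
void. This disposes of hopeless subtrees, for which no finite difference `t` of payments exists. -/
theorem HasSurplus.of_top {d : ℕ} {T : ProtocolTree n} {h : Finset (Fin n) → ℝ≥0 → ℝ≥0}
    (hT : T.HasSurplus d ∞ h) (h' : Finset (Fin n) → ℝ≥0 → ℝ≥0) : T.HasSurplus d ∞ h' := by
  refine ⟨fun x r δ _ => ⟨fun _ => true, by simp⟩, fun s x r => ?_⟩
  have h1 := hT.2 s x r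
  have : T.expPay s = ∞ := by simpa using h1
  simp [this]

/-- At truncation depth `0` all values are lost, so the surplus vanishes; the empty bundle
represents the zero function as an `IsSurplus`. -/
theorem hasSurplus_zero (T : ProtocolTree n) :
    T.HasSurplus 0 (⨅ s, T.expPay s) fun x r => hardValuation x r ∅ := by
  constructor
  · intro x r δ hδ
    simp only [hardValuation, Finset.inter_empty, if_true, ENNReal.coe_zero, add_zero]
    rcases eq_or_ne (⨅ s, T.expPay s) ∞ with h | h
    · exact ⟨fun _ => true, by simp [h]⟩
    · obtain ⟨s, hs⟩ := iInf_lt_iff.1 (ENNReal.lt_add_right h hδ)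
      exact ⟨s, hs.le.trans (by gcongr; exact le_add_self)⟩
  · intro s x r
    rw [truncValue_zero, zero_add]
    exact (iInf_le _ s).trans le_add_self

theorem hasSurplus_of_leaf {T : ProtocolTree n} {S : Finset (Fin n)} {q : ℝ≥0}
    (hT : T [] = NodeLabel.leaf S q) (d : ℕ) :
    T.HasSurplus (d + 1) q fun x r => hardValuation x r S := by
  constructor
  · intro x r δ _
    refine ⟨fun _ => true, ?_⟩
    rw [expPay, expValue, leafExp_of_leaf hT, leafExp_of_leaf hT, add_comm]
    exact le_self_add
  · intro s x r
    simp [truncValue, expPay, leafExp_of_leaf hT]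

/-- The buyer optimizes separately in the two subtrees, so least payments and surpluses average with
the same weights. -/
theorem hasSurplus_of_chance {T : ProtocolTree n} {μ : PMF Bool} (hT : T [] = NodeLabel.chance μ)
    {d : ℕ} {p : Bool → ℝ≥0∞} {h : Bool → Finset (Fin n) → ℝ≥0 → ℝ≥0}
    (hp : ∀ b, (T.sub b).HasSurplus d (p b) (h b)) :
    T.HasSurplus (d + 1) (μ false * p false + μ true * p true)
      fun x r => (μ false).toNNReal * h false x r + (μ true).toNNReal * h true x r := by
  have hμ : μ false + μ true = 1 := by
    rw [← tsum_bool, μ.tsum_coe]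
  have hc : ∀ b, (((μ b).toNNReal : ℝ≥0) : ℝ≥0∞) = μ b := fun b =>
    ENNReal.coe_toNNReal (μ.apply_ne_top b)
  constructor
  · intro x r δ hδ
    choose σ hσ using fun b => (hp b).1 x r δ hδ
    refine ⟨Strategy.glue true σ, ?_⟩
    simp only [expPay, expValue] at hσ ⊢
    rw [leafExp_of_chance hT, leafExp_of_chance hT]
    simp only [Strategy.sub_glue]
    push_cast
    rw [hc, hc]
    calc _ = μ false * ((T.sub false).leafExp (σ false) (fun _ _ q => (q : ℝ≥0∞)) + h false x r)
          + μ true * ((T.sub true).leafExp (σ true) (fun _ _ q => (q : ℝ≥0∞)) + h true x r) := by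
          ring
      _ ≤ _ := add_le_add (mul_le_mul_right (hσ false) _) (mul_le_mul_right (hσ true) _)
      _ = _ := by
        conv_rhs => rw [← one_mul δ, ← hμ]
        ring
  · intro s x r
    have h0 := (hp false).2 (s.sub false) x r
    have h1 := (hp true).2 (s.sub true) x r
    simp only [expPay, truncValue] at h0 h1 ⊢
    rw [leafExp_of_chance hT, leafExp_of_chance hT]
    simp only [Nat.add_lt_add_iff_right]
    push_cast
    rw [hc, hc]
    refine le_trans (le_of_eq ?_) ((add_le_add (mul_le_mul_right h0 (μ false))
      (mul_le_mul_right h1 (μ true))).trans (le_of_eq ?_)) <;> ring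

/-- Child `b` has the smaller least payment, which becomes the reference; moving to the other child
costs `t` more, and this is deducted from its surplus. If the other child has infinite least
payment, `ht'` makes it a copy of `b`, so that the maximum ignores it. -/
theorem hasSurplus_of_buyer {T : ProtocolTree n} (hT : T [] = NodeLabel.buyer)
    {d : ℕ} {p : Bool → ℝ≥0∞} {h : Bool → Finset (Fin n) → ℝ≥0 → ℝ≥0}
    (hp : ∀ b, (T.sub b).HasSurplus d (p b) (h b)) {b : Bool} (hb : p b ≤ p (!b)) {t : ℝ≥0}
    (ht : p (!b) ≠ ∞ → p (!b) = p b + t) (ht' : p (!b) = ∞ → h (!b) = h b ∧ t = 0) :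
    T.HasSurplus (d + 1) (p b) fun x r => max (h b x r) (h (!b) x r - t) := by
  have hpay : ∀ s, T.expPay s = (T.sub (s [])).expPay (s.sub (s [])) := fun s =>
    leafExp_of_buyer hT s _
  have hval : ∀ s v, T.expValue s v = (T.sub (s [])).expValue (s.sub (s [])) v := fun s v =>
    leafExp_of_buyer hT s _
  have htr : ∀ s v, T.truncValue (d + 1) s v = (T.sub (s [])).truncValue d (s.sub (s [])) v := by
    intro s v
    rw [truncValue, leafExp_of_buyer hT]
    simp only [Nat.add_lt_add_iff_right]
    rfl
  constructor
  · intro x r δ hδ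
    choose σ hσ using fun b => (hp b).1 x r δ hδ
    have first : ∀ y : ℝ≥0, y ≤ h b x r → ∃ s, T.expPay s + y ≤
        T.expValue s (hardValuation x r) + p b + δ := by
      intro y hy
      refine ⟨Strategy.glue b σ, ?_⟩
      rw [hpay, hval]
      simp only [Strategy.glue_nil, Strategy.sub_glue]
      refine le_trans ?_ (hσ b)
      gcongr
    rcases le_total (h (!b) x r - t) (h b x r) with hle | hle
    · exact first _ (max_le le_rfl hle)
    · simp only [max_eq_right hle]
      by_cases hpb : p b = ∞
      · exact ⟨fun _ => true, by simp [hpb]⟩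
      by_cases hnb : p (!b) = ∞
      · obtain ⟨h1, h2⟩ := ht' hnb
        exact first _ (by rw [h1, h2, tsub_zero])
      rcases le_total (h (!b) x r) t with hlt | hlt
      · exact first _ (by rw [tsub_eq_zero_of_le hlt]; exact zero_le)
      -- Here the subtraction `h (!b) x r - t` is not truncated, so the expensive child really
      -- attains the maximum.
      refine ⟨Strategy.glue (!b) σ, ?_⟩
      rw [hpay, hval]
      simp only [Strategy.glue_nil, Strategy.sub_glue]
      have h1 := hσ (!b)
      rw [ht hnb] at h1
      have h2 : ((h (!b) x r : ℝ≥0) : ℝ≥0∞) = ((h (!b) x r - t : ℝ≥0) : ℝ≥0∞) + t := by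
        rw [← ENNReal.coe_add, tsub_add_cancel_of_le hlt]
      rw [h2] at h1
      refine (ENNReal.add_le_add_iff_right (a := (t : ℝ≥0∞)) ENNReal.coe_ne_top).1 ?_
      refine le_trans (le_of_eq ?_) (h1.trans (le_of_eq ?_)) <;> ring
  · intro s x r
    rw [hpay, htr]
    have h1 := (hp (s [])).2 (s.sub (s [])) x r
    by_cases hs : s [] = b
    · rw [hs] at h1 ⊢
      refine h1.trans ?_
      gcongr
      exact le_max_left _ _
    · have hs' : s [] = !b := by
        revert hs
        cases s [] <;> cases b <;> simp
      rw [hs'] at h1 ⊢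
      by_cases hnb : p (!b) = ∞
      · rw [hnb] at h1
        have : (T.sub (!b)).expPay (s.sub (!b)) = ∞ := by simpa using h1
        simp [this]
      · rw [ht hnb] at h1
        refine (ENNReal.add_le_add_iff_right (a := (t : ℝ≥0∞)) ENNReal.coe_ne_top).1 ?_
        calc _ = _ := add_assoc _ _ _
          _ ≤ _ := h1
          _ ≤ ((h (!b) x r - t + t : ℝ≥0) : ℝ≥0∞) + (T.sub (!b)).expPay (s.sub (!b)) := by
            gcongr
            exact le_tsub_add
          _ ≤ _ := by
            push_cast
            rw [add_right_comm]
            gcongr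
            rw [← ENNReal.coe_sub]
            exact_mod_cast le_max_right _ _

theorem exists_hasSurplus (d : ℕ) (T : ProtocolTree n) :
    ∃ p h, IsSurplus d h ∧ T.HasSurplus d p h := by
  induction d generalizing T with
  | zero => exact ⟨_, _, IsSurplus.leaf 0 ∅, hasSurplus_zero T⟩
  | succ d ih =>
    cases hT : T [] with
    | leaf S q => exact ⟨_, _, IsSurplus.leaf _ S, hasSurplus_of_leaf hT d⟩
    | chance μ =>
      choose p h hh hp using fun b => ih (T.sub b)
      refine ⟨_, _, IsSurplus.chance _ _ ?_ (hh false) (hh true), hasSurplus_of_chance hT hp⟩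
      rw [← ENNReal.toNNReal_add (μ.apply_ne_top _) (μ.apply_ne_top _), ← tsum_bool,
        μ.tsum_coe, ENNReal.toNNReal_one]
    | buyer =>
      choose p h hh hp using fun b => ih (T.sub b)
      obtain ⟨b, hb⟩ : ∃ b, p b ≤ p (!b) := by
        rcases le_total (p false) (p true) with h | h
        · exact ⟨false, h⟩
        · exact ⟨true, h⟩
      by_cases hnb : p (!b) = ∞
      · refine ⟨_, _, IsSurplus.buyer 0 (hh b) (hh b),
          hasSurplus_of_buyer (h := fun _ => h b) hT (fun c => ?_) hb (fun h => absurd hnb h)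
            fun _ => ⟨rfl, rfl⟩⟩
        by_cases hc : c = b
        · exact hc ▸ hp c
        · have hc' : c = !b := by
            revert hc
            cases c <;> cases b <;> simp
          have h2 := hp c
          rw [hc', hnb] at h2 ⊢
          exact h2.of_top _
      · refine ⟨_, _, IsSurplus.buyer (p (!b) - p b).toNNReal (hh b) (hh (!b)),
          hasSurplus_of_buyer hT hp hb (fun _ => ?_) fun h => absurd h hnb⟩
        rw [ENNReal.coe_toNNReal (by simp [hnb]), add_tsub_cancel_of_le hb]

end ProtocolTree

/-! ### Payments bounded by surplus. -/

namespace ProtocolTree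

variable {n : ℕ}

theorem expValue_ne_top {T : ProtocolTree n} (hfin : T.IsFinite) (s : Strategy)
    (v : BundleValuation n) : T.expValue s v ≠ ∞ := by
  refine ne_top_of_le_ne_top (b := ((Finset.univ.sup v : ℝ≥0) : ℝ≥0∞)) ENNReal.coe_ne_top ?_
  calc T.expValue s v ≤ T.leafExp s (fun _ _ _ => ((Finset.univ.sup v : ℝ≥0) : ℝ≥0∞) * 1) :=
        leafExp_mono T s fun d S q => by
          rw [mul_one]
          exact_mod_cast Finset.le_sup (f := v) (Finset.mem_univ S)
    _ = _ := by
      rw [leafExp_const_mul]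
      change _ * T.terminationProb s = _
      rw [hfin s, mul_one]

/-- Comparison with opting out bounds the payment by the finite expected value plus `ε`. Finiteness
is what permits cancellation in `ℝ≥0∞`. -/
theorem expPay_ne_top_of_approx {T : ProtocolTree n} (hfin : T.IsFinite) (hT : T.IsIR)
    {v : BundleValuation n} {ε : ℝ≥0} {s : Strategy}
    (hs : ∀ s', T.expValue s' v + T.expPay s ≤ T.expValue s v + T.expPay s' + ε) :
    T.expPay s ≠ ∞ := by
  obtain ⟨s₀, h0, -⟩ := hT
  have h1 := hs s₀
  rw [h0, add_zero] at h1
  refine ne_top_of_le_ne_top ?_ (le_add_self.trans h1)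
  simp [expValue_ne_top hfin]

/-- The surplus function of an individually rational tree controls the expected payments of all
approximately optimal strategies. -/
theorem exists_surplus_bound {T : ProtocolTree n} (hfin : T.IsFinite) (hT : T.IsIR) {d : ℕ}
    (hd : d ≠ 0) :
    ∃ h, IsSurplus d h ∧ ∀ (x : Finset (Fin n)) (r ε : ℝ≥0) (s : Strategy), r ≤ 1 →
      (∀ s', T.expValue s' (hardValuation x r) + T.expPay s ≤
        T.expValue s (hardValuation x r) + T.expPay s' + ε) →
      2 * (h x r : ℝ≥0∞) + T.expPay s ≤ h x (2 * r) + 2 * (T.expDepth s / d) + 2 * ε := by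
  obtain ⟨p, h, hh, h1, h2⟩ := exists_hasSurplus d T
  refine ⟨h, hh, fun x r ε s hr hs => ?_⟩
  -- Opting out pays nothing, and a type of value `0` has no surplus, so the least payment is `0`.
  have hp : p = 0 := by
    obtain ⟨s₀, h0, -⟩ := hT
    have h3 := h2 s₀ x 0
    rw [h0, nonpos_iff_eq_zero.1 (hh.le x 0)] at h3
    simpa using (le_add_self.trans h3 : p ≤ _)
  subst hp
  have hP := expPay_ne_top_of_approx hfin hT hs
  -- A nearly optimal strategy `s` earns the surplus up to `ε`: compare it with a strategy `s'` that
  -- attains `h x r` up to `δ`.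
  have upper : (h x r : ℝ≥0∞) + T.expPay s ≤ T.expValue s (hardValuation x r) + ε := by
    refine ENNReal.le_of_forall_pos_le_add fun δ hδ _ => ?_
    obtain ⟨s', hs'⟩ := h1 x r δ (by simpa using hδ.ne')
    rw [add_zero] at hs'
    have hV' := expValue_ne_top hfin s' (hardValuation x r)
    have hP' : T.expPay s' ≠ ∞ :=
      ne_top_of_le_ne_top (by simp [hV']) (le_self_add.trans hs')
    refine (ENNReal.add_le_add_iff_right
      (a := T.expPay s' + T.expValue s' (hardValuation x r)) (by simp [hV', hP'])).1 ?_
    refine le_trans (le_of_eq ?_) ((add_le_add hs' (hs s')).trans (le_of_eq ?_)) <;> ring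
  -- The type of value `2 * r` copies `s`.
  have h4 := h2 s x (2 * r)
  rw [truncValue_hardValuation, add_zero] at h4
  have h5 := expValue_le_truncValue_add hd T s (hardValuation x r)
    fun S => (hardValuation_le x r S).trans hr
  refine (ENNReal.add_le_add_iff_right hP).1 ?_
  calc 2 * (h x r : ℝ≥0∞) + T.expPay s + T.expPay s = 2 * (h x r + T.expPay s) := by ring
    _ ≤ 2 * (T.truncValue d s (hardValuation x r) + T.expDepth s / d + ε) := by
      refine mul_le_mul_right (upper.trans ?_) 2
      gcongr
    _ = (2 : ℝ≥0) * T.truncValue d s (hardValuation x r) + 2 * (T.expDepth s / d) + 2 * ε := by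
      push_cast
      ring
    _ ≤ (h x (2 * r) + T.expPay s) + 2 * (T.expDepth s / d) + 2 * ε := by gcongr
    _ = _ := by ring

end ProtocolTree

/-! ### Finite nets of surplus functions -/

/-- A finite set of surplus functions of depth `d` that approximates all others up to `2 d / M`. -/
theorem exists_surplus_net (n M : ℕ) (hM : M ≠ 0) (d : ℕ) :
    ∃ N : Set (Finset (Fin n) → ℝ≥0 → ℝ≥0), N.Finite ∧ (∀ h ∈ N, IsSurplus d h) ∧
      N.ncard * (5 * M) ≤ (5 * M * 2 ^ n) ^ (2 ^ d) ∧
      ∀ h, IsSurplus d h → ∃ h' ∈ N, ∀ x, ∀ r ≤ 2, |(h x r : ℝ) - h' x r| ≤ 2 * d / M := by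
  induction d with
  | zero =>
    refine ⟨Set.range fun S x r => hardValuation x r S, Set.finite_range _, ?_, ?_, ?_⟩
    · rintro _ ⟨S, rfl⟩
      exact IsSurplus.leaf 0 S
    · rw [pow_zero, pow_one, mul_comm]
      gcongr
      rw [← Set.image_univ]
      refine (Set.ncard_image_le).trans ?_
      simp [Set.ncard_univ]
    · rintro _ (⟨_, S⟩)
      exact ⟨_, ⟨S, rfl⟩, by simp⟩
  | succ d ih =>
    obtain ⟨N, hfin, hN, hcard, happ⟩ := ih
    let A : Set (Finset (Fin n) → ℝ≥0 → ℝ≥0) :=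
      (fun z : ((Finset (Fin n) → ℝ≥0 → ℝ≥0) × (Finset (Fin n) → ℝ≥0 → ℝ≥0)) × ℕ =>
        fun (x : Finset (Fin n)) (r : ℝ≥0) => max (z.1.1 x r) (z.1.2 x r - (z.2 : ℝ≥0) / M)) ''
        ((N ×ˢ N) ×ˢ Set.Iic (2 * M))
    let B : Set (Finset (Fin n) → ℝ≥0 → ℝ≥0) :=
      (fun z : ((Finset (Fin n) → ℝ≥0 → ℝ≥0) × (Finset (Fin n) → ℝ≥0 → ℝ≥0)) × ℕ =>
        fun (x : Finset (Fin n)) (r : ℝ≥0) => ((z.2 : ℝ≥0) / M) * z.1.1 x r +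
        (1 - (z.2 : ℝ≥0) / M) * z.1.2 x r) '' ((N ×ˢ N) ×ˢ Set.Iic M)
    have hA : A.Finite := ((hfin.prod hfin).prod (Set.finite_Iic _)).image _
    have hB : B.Finite := ((hfin.prod hfin).prod (Set.finite_Iic _)).image _
    have hM0 : (0 : ℝ) < M := by positivity
    have hM0' : (0 : ℝ≥0) < M := by positivity
    refine ⟨A ∪ B, hA.union hB, ?_, ?_, ?_⟩
    · rintro _ (⟨⟨⟨h₀, h₁⟩, i⟩, ⟨⟨h0, h1⟩, hi⟩, rfl⟩ | ⟨⟨⟨h₀, h₁⟩, i⟩, ⟨⟨h0, h1⟩, hi⟩, rfl⟩)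
      · exact IsSurplus.buyer _ (hN _ h0) (hN _ h1)
      · refine IsSurplus.chance _ _ (add_tsub_cancel_of_le ?_) (hN _ h0) (hN _ h1)
        rw [div_le_one hM0']
        exact_mod_cast hi
    · have cA : A.ncard ≤ N.ncard * N.ncard * (2 * M + 1) := by
        refine (Set.ncard_image_le ((hfin.prod hfin).prod (Set.finite_Iic _))).trans ?_
        rw [Set.ncard_prod, Set.ncard_prod]
        simp [Set.ncard_eq_toFinset_card']
      have cB : B.ncard ≤ N.ncard * N.ncard * (M + 1) := by
        refine (Set.ncard_image_le ((hfin.prod hfin).prod (Set.finite_Iic _))).trans ?_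
        rw [Set.ncard_prod, Set.ncard_prod]
        simp [Set.ncard_eq_toFinset_card']
      -- With the factor `5 * M` included, the recursion for the cardinality becomes plain squaring,
      -- since `(2 * M + 1) + (M + 1) ≤ 5 * M`.
      calc (A ∪ B).ncard * (5 * M)
          ≤ (N.ncard * N.ncard * (2 * M + 1) + N.ncard * N.ncard * (M + 1)) * (5 * M) := by
            gcongr
            exact (Set.ncard_union_le A B).trans (by gcongr)
        _ = N.ncard * N.ncard * (3 * M + 2) * (5 * M) := by ring
        _ ≤ N.ncard * N.ncard * (5 * M) * (5 * M) := by
            gcongr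
            omega
        _ = (N.ncard * (5 * M)) ^ 2 := by ring
        _ ≤ ((5 * M * 2 ^ n) ^ (2 ^ d)) ^ 2 := by gcongr
        _ = _ := by rw [← pow_mul, pow_succ]
    · intro h hh
      cases hh with
      | leaf _ S =>
        -- A leaf is found in the new net as the maximum of two equal functions with `t = 0`.
        obtain ⟨h', hN', h1⟩ := happ _ (IsSurplus.leaf d S)
        refine ⟨_, Or.inl ⟨((h', h'), 0), ⟨⟨hN', hN'⟩, by simp⟩, rfl⟩, fun x r hr => ?_⟩
        have := h1 x r hr
        simp only [Nat.cast_zero, zero_div, tsub_zero, max_self]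
        refine this.trans ?_
        gcongr
        simp
      | buyer t a₀ a₁ =>
        rename_i h₀ h₁
        obtain ⟨g₀, m₀, e₀⟩ := happ _ a₀
        obtain ⟨g₁, m₁, e₁⟩ := happ _ a₁
        -- Round `t` down to a multiple of `1 / M` and cap it at `2`: since surpluses are at most `r
        -- ≤ 2`, every `t ≥ 2` makes the second option worthless.
        refine ⟨_, Or.inl ⟨((g₀, g₁), min (2 * M) ⌊(t : ℝ) * M⌋₊), ⟨⟨m₀, m₁⟩, ?_⟩, rfl⟩,
          fun x r hr => ?_⟩
        · exact Set.mem_Iic.2 (min_le_left _ _)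
        · have k₀ := e₀ x r hr
          have k₁ := e₁ x r hr
          have l₁ : (h₁ x r : ℝ) ≤ 2 := by exact_mod_cast (a₁.le x r).trans hr
          have l₁' : (g₁ x r : ℝ) ≤ 2 := by exact_mod_cast ((hN _ m₁).le x r).trans hr
          have herr : (2 * ((d + 1 : ℕ) : ℝ) / M) = 2 * d / M + 2 / M := by
            push_cast
            ring
          have hinv : (0 : ℝ) < 2 / M := by positivity
          have hinv2 : (1 : ℝ) / M + 1 / M = 2 / M := by ring
          have hinv' : (0 : ℝ) < 1 / M := by positivity
          rw [herr]
          simp only [NNReal.coe_max, NNReal.coe_sub_def, NNReal.coe_div, NNReal.coe_natCast]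
          refine (abs_max_sub_max_le_max _ _ _ _).trans (max_le (by linarith) ?_)
          rcases le_total ⌊(t : ℝ) * M⌋₊ (2 * M) with hle | hle
          · rw [min_eq_right hle]
            refine (abs_max_sub_max_le_abs _ _ _).trans ?_
            have f1 : (⌊(t : ℝ) * M⌋₊ : ℝ) / M ≤ t := by
              rw [div_le_iff₀ hM0]
              exact Nat.floor_le (by positivity)
            have f2 : (t : ℝ) ≤ (⌊(t : ℝ) * M⌋₊ : ℝ) / M + 1 / M := by
              rw [← add_div, le_div_iff₀ hM0]
              exact (Nat.lt_floor_add_one _).le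
            rw [abs_le] at k₁ ⊢
            constructor <;> linarith
          · rw [min_eq_left hle]
            have f1 : (2 : ℝ) ≤ t := by
              have : ((2 * M : ℕ) : ℝ) ≤ t * M := (Nat.cast_le.2 hle).trans (Nat.floor_le (by positivity))
              push_cast at this
              exact le_of_mul_le_mul_right this hM0
            have f2 : ((2 * M : ℕ) : ℝ) / M = 2 := by
              push_cast
              field_simp
            rw [f2, max_eq_right (by linarith), max_eq_right (by linarith)]
            have := abs_nonneg ((h₀ x r : ℝ) - g₀ x r)
            simp only [sub_zero, abs_zero]
            linarith
      | chance p₀ p₁ hp a₀ a₁ =>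
        rename_i h₀ h₁
        obtain ⟨g₀, m₀, e₀⟩ := happ _ a₀
        obtain ⟨g₁, m₁, e₁⟩ := happ _ a₁
        have hp1 : p₀ ≤ 1 := hp ▸ le_self_add
        have hfl : ⌊(p₀ : ℝ) * M⌋₊ ≤ M := by
          refine Nat.floor_le_of_le ?_
          have : (p₀ : ℝ) ≤ 1 := by exact_mod_cast hp1
          nlinarith
        refine ⟨_, Or.inr ⟨((g₀, g₁), ⌊(p₀ : ℝ) * M⌋₊), ⟨⟨m₀, m₁⟩, hfl⟩, rfl⟩,
          fun x r hr => ?_⟩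
        have k₀ := e₀ x r hr
        have k₁ := e₁ x r hr
        have l₀ : (g₀ x r : ℝ) ≤ 2 := by exact_mod_cast ((hN _ m₀).le x r).trans hr
        have l₁ : (g₁ x r : ℝ) ≤ 2 := by exact_mod_cast ((hN _ m₁).le x r).trans hr
        have hp' : (p₁ : ℝ) = 1 - p₀ := by
          rw [← NNReal.coe_one, ← hp]
          simp
        have f1 : (⌊(p₀ : ℝ) * M⌋₊ : ℝ) / M ≤ p₀ := by
          rw [div_le_iff₀ hM0]
          exact Nat.floor_le (by positivity)
        have f2 : (p₀ : ℝ) ≤ (⌊(p₀ : ℝ) * M⌋₊ : ℝ) / M + 1 / M := by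
          rw [← add_div, le_div_iff₀ hM0]
          exact (Nat.lt_floor_add_one _).le
        have f3 : ((⌊(p₀ : ℝ) * M⌋₊ : ℝ≥0) / M : ℝ≥0) ≤ 1 := by
          rw [div_le_one hM0']
          exact_mod_cast hfl
        have herr : (2 * ((d + 1 : ℕ) : ℝ) / M) = 2 * d / M + 1 / M * 2 := by
          push_cast
          ring
        have hinv : (0 : ℝ) ≤ 1 / M := by positivity
        rw [herr]
        push_cast [NNReal.coe_sub f3]
        rw [hp']
        set i := (⌊(p₀ : ℝ) * M⌋₊ : ℝ) / M
        have q0 : (0 : ℝ) ≤ p₀ := p₀.2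
        have q1 : (p₀ : ℝ) ≤ 1 := by exact_mod_cast hp1
        have g0 : (0 : ℝ) ≤ g₀ x r := (g₀ x r).2
        have g1 : (0 : ℝ) ≤ g₁ x r := (g₁ x r).2
        -- The first part averages the errors of the children; the last is the rounding of the
        -- probability, at most `1 / M` times a difference of surpluses in `[0, 2]`.
        have split : (p₀ : ℝ) * h₀ x r + (1 - p₀) * h₁ x r - (i * g₀ x r + (1 - i) * g₁ x r) =
            p₀ * (h₀ x r - g₀ x r) + (1 - p₀) * (h₁ x r - g₁ x r) +
              (p₀ - i) * (g₀ x r - g₁ x r) := by ring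
        rw [split]
        have b1 : |(p₀ : ℝ) * (h₀ x r - g₀ x r) + (1 - p₀) * (h₁ x r - g₁ x r)| ≤ 2 * d / M := by
          refine (abs_add_le _ _).trans ?_
          rw [abs_mul, abs_mul, abs_of_nonneg q0, abs_of_nonneg (sub_nonneg.2 q1)]
          nlinarith
        have b2 : |((p₀ : ℝ) - i) * (g₀ x r - g₁ x r)| ≤ 1 / M * 2 := by
          rw [abs_mul]
          refine mul_le_mul ?_ ?_ (abs_nonneg _) hinv
          · rw [abs_le]
            constructor <;> linarith
          · rw [abs_le]
            constructor <;> linarith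
        exact (abs_add_le _ _).trans (add_le_add b1 b2)

/-! ### A random choice of values -/

/-- A union bound over a finite family of bounded sums of independent random variables. -/
theorem exists_choice_forall_sum_le {ι J γ : Type*} [Fintype ι] [Fintype J]
    (w : J → ℝ) (hw : ∀ j, 0 ≤ w j) (hw1 : ∑ j, w j = 1) (G : Finset γ) (g : γ → ι → J → ℝ)
    (μ : γ → ℝ) {s : ℝ} (hs0 : 0 ≤ s) (hs : s ≤ 4) (hg : ∀ a ∈ G, ∀ i j, |g a i j| ≤ 2)
    (hμ : ∀ a ∈ G, ∀ i, ∑ j, w j * g a i j ≤ μ a)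
    (hcard : (G.card : ℝ) * Real.exp (-(Fintype.card ι * s ^ 2 / 16)) < 1) :
    ∃ φ : ι → J, ∀ a ∈ G, ∑ i, g a i (φ i) ≤ Fintype.card ι * (μ a + s) := by
  classical
  by_contra! hcon
  have hW : ∑ φ : ι → J, ∏ i, w (φ i) = 1 := by
    rw [← Fintype.prod_sum]
    simp [hw1]
  set l := s / 8 with hl
  have hmgf : ∀ a ∈ G, ∀ i, ∑ j, w j * Real.exp (l * g a i j) ≤
      Real.exp (l * μ a + 4 * l ^ 2) := by
    intro a ha i
    have hb : ∀ j, w j * Real.exp (l * g a i j) ≤ w j + l * (w j * g a i j) + w j * (4 * l ^ 2) := by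
      intro j
      have h1 := hg a ha i j
      have h2 : |l * g a i j| ≤ 1 := by
        rw [abs_mul, abs_of_nonneg (by positivity : 0 ≤ l)]
        nlinarith [abs_nonneg (g a i j)]
      have h3 := (abs_le.1 (Real.abs_exp_sub_one_sub_id_le h2)).2
      have h4 : (l * g a i j) ^ 2 ≤ 4 * l ^ 2 := by
        rw [mul_pow, ← sq_abs (g a i j)]
        have : |g a i j| ^ 2 ≤ 2 ^ 2 := by gcongr
        nlinarith [sq_nonneg l]
      nlinarith [mul_le_mul_of_nonneg_left (by linarith :
        Real.exp (l * g a i j) ≤ 1 + l * g a i j + 4 * l ^ 2) (hw j)]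
    calc ∑ j, w j * Real.exp (l * g a i j)
        ≤ ∑ j, (w j + l * (w j * g a i j) + w j * (4 * l ^ 2)) := Finset.sum_le_sum fun j _ => hb j
      _ = 1 + l * ∑ j, w j * g a i j + 4 * l ^ 2 := by
        rw [Finset.sum_add_distrib, Finset.sum_add_distrib, ← Finset.mul_sum, ← Finset.sum_mul,
          hw1, one_mul]
      _ ≤ (l * μ a + 4 * l ^ 2) + 1 := by
        have := mul_le_mul_of_nonneg_left (hμ a ha i) (by positivity : 0 ≤ l)
        linarith
      _ ≤ _ := Real.add_one_le_exp _
  set N : ℝ := (Fintype.card ι : ℝ) with hN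
  -- If every `φ` fails for some `a`, then for every `φ` some exponential is at least `1`; average
  -- over the product distribution.
  have hone : (1 : ℝ) ≤ ∑ a ∈ G, ∑ φ : ι → J,
      (∏ i, w (φ i)) * Real.exp (l * (∑ i, g a i (φ i) - N * (μ a + s))) := by
    rw [Finset.sum_comm, ← hW]
    refine Finset.sum_le_sum fun φ _ => ?_
    obtain ⟨a, ha, h⟩ := hcon φ
    have hnn : ∀ b ∈ G, 0 ≤ (∏ i, w (φ i)) *
        Real.exp (l * (∑ i, g b i (φ i) - N * (μ b + s))) := fun b _ =>
      mul_nonneg (Finset.prod_nonneg fun i _ => hw _) (Real.exp_nonneg _)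
    refine le_trans ?_ (Finset.single_le_sum hnn ha)
    refine le_mul_of_one_le_right (Finset.prod_nonneg fun i _ => hw _) ?_
    refine Real.one_le_exp (mul_nonneg (by positivity) ?_)
    linarith
  have hbound : ∀ a ∈ G, ∑ φ : ι → J,
      (∏ i, w (φ i)) * Real.exp (l * (∑ i, g a i (φ i) - N * (μ a + s))) ≤
        Real.exp (-(N * s ^ 2 / 16)) := by
    intro a ha
    calc _ = ∑ φ : ι → J, (∏ i, w (φ i) * Real.exp (l * g a i (φ i))) *
          Real.exp (-(l * (N * (μ a + s)))) := by
          refine Finset.sum_congr rfl fun φ _ => ?_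
          rw [Finset.prod_mul_distrib, ← Real.exp_sum, mul_assoc, ← Real.exp_add, ← Finset.mul_sum]
          ring_nf
      _ = (∏ i, ∑ j, w j * Real.exp (l * g a i j)) * Real.exp (-(l * (N * (μ a + s)))) := by
        rw [← Finset.sum_mul, Fintype.prod_sum]
      _ ≤ (∏ _i : ι, Real.exp (l * μ a + 4 * l ^ 2)) * Real.exp (-(l * (N * (μ a + s)))) := by
        gcongr with i _
        · intro i _
          exact Finset.sum_nonneg fun j _ => mul_nonneg (hw j) (Real.exp_nonneg _)
        · exact hmgf a ha i
      _ = _ := by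
        rw [Finset.prod_const, Finset.card_univ, ← Real.exp_nat_mul, ← Real.exp_add]
        congr 1
        rw [← hN, hl]
        ring
  have := (hone.trans (Finset.sum_le_sum hbound))
  rw [Finset.sum_const, nsmul_eq_mul] at this
  linarith

/-! ### A code of sets -/

/-- Greedy choice of functions that agree in few places. -/
theorem exists_code (m B : ℕ) (hm : 0 < m) (hB : 2 ≤ B) :
    ∃ X : Finset (Fin m → Fin (8 ^ B)), 4 ^ m ≤ X.card ∧
      ∀ f ∈ X, ∀ g ∈ X, f ≠ g → B * (Finset.univ.filter fun i => f i = g i).card ≤ m := by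
  classical
  let P : Finset (Fin m → Fin (8 ^ B)) → Prop := fun X =>
    ∀ f ∈ X, ∀ g ∈ X, f ≠ g → B * (Finset.univ.filter fun i => f i = g i).card ≤ m
  -- By maximality the balls of words that agree too often with a codeword cover everything, so a
  -- bound on their size bounds the number of codewords from below.
  obtain ⟨X, hX, hmax⟩ := (Finset.univ.filter P).exists_max_image Finset.card
    ⟨∅, by simp [P]⟩
  have hPX : P X := (Finset.mem_filter.1 hX).2
  refine ⟨X, ?_, hPX⟩
  let ball : (Fin m → Fin (8 ^ B)) → Finset (Fin m → Fin (8 ^ B)) := fun f =>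
    Finset.univ.filter fun g => m < B * (Finset.univ.filter fun i => f i = g i).card
  have hcover : ∀ g, ∃ f ∈ X, g ∈ ball f := by
    intro g
    by_contra! hg
    simp only [ball, Finset.mem_filter, Finset.mem_univ, true_and, not_lt] at hg
    have hgX : g ∉ X := fun h => by
      have := hg g h
      simp only [Finset.filter_true, Finset.card_univ, Fintype.card_fin] at this
      nlinarith
    have hP : P (insert g X) := by
      intro f hf f' hf' hne
      rcases Finset.mem_insert.1 hf with rfl | hfX <;>
        rcases Finset.mem_insert.1 hf' with rfl | hfX'
      · exact absurd rfl hne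
      · simpa only [eq_comm] using hg f' hfX'
      · exact hg f hfX
      · exact hPX f hfX f' hfX' hne
    have := hmax (insert g X) (by simp [hP])
    rw [Finset.card_insert_of_notMem hgX] at this
    omega
  -- Union bound over the at most `2 ^ m` agreement sets `A`: fixing more than `m / B` letters of an
  -- alphabet of size `8 ^ B` leaves at most a fraction `8 ^ (-m)` of the words.
  have hball : ∀ f, (ball f).card * 8 ^ m ≤ 2 ^ m * (8 ^ B) ^ m := by
    intro f
    let cyl : Finset (Fin m) → Finset (Fin m → Fin (8 ^ B)) := fun A =>
      Fintype.piFinset fun i => if i ∈ A then {f i} else Finset.univ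
    have hcyl : ∀ A, (cyl A).card * (8 ^ B) ^ A.card = (8 ^ B) ^ m := by
      intro A
      have : ∀ i, (if i ∈ A then ({f i} : Finset (Fin (8 ^ B))) else Finset.univ).card *
          (if i ∈ A then 8 ^ B else 1) = 8 ^ B := by
        intro i
        split_ifs <;> simp
      calc _ = ∏ i, ((if i ∈ A then ({f i} : Finset (Fin (8 ^ B))) else Finset.univ).card *
          (if i ∈ A then 8 ^ B else 1)) := by
            rw [Finset.prod_mul_distrib, Fintype.card_piFinset, Finset.prod_ite_mem,
              Finset.univ_inter, Finset.prod_const]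
        _ = _ := by simp [this]
    have hsub : ball f ⊆ (Finset.univ.filter fun A : Finset (Fin m) => m < B * A.card).biUnion
        cyl := by
      intro g hg
      simp only [ball, Finset.mem_filter, Finset.mem_univ, true_and] at hg
      refine Finset.mem_biUnion.2 ⟨_, Finset.mem_filter.2 ⟨Finset.mem_univ _, hg⟩, ?_⟩
      rw [Fintype.mem_piFinset]
      intro i
      split_ifs with h
      · simp only [Finset.mem_filter, Finset.mem_univ, true_and] at h
        simp [h]
      · simp
    calc (ball f).card * 8 ^ m
        ≤ (∑ A ∈ Finset.univ.filter fun A : Finset (Fin m) => m < B * A.card, (cyl A).card) * 8 ^ m := by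
          gcongr
          exact (Finset.card_le_card hsub).trans Finset.card_biUnion_le
      _ = ∑ A ∈ Finset.univ.filter fun A : Finset (Fin m) => m < B * A.card,
          (cyl A).card * 8 ^ m := Finset.sum_mul ..
      _ ≤ ∑ A ∈ Finset.univ.filter fun A : Finset (Fin m) => m < B * A.card, (8 ^ B) ^ m := by
        refine Finset.sum_le_sum fun A hA => ?_
        rw [← hcyl A, ← pow_mul]
        gcongr
        · norm_num
        · exact (Finset.mem_filter.1 hA).2.le
      _ ≤ 2 ^ m * (8 ^ B) ^ m := by
        rw [Finset.sum_const, smul_eq_mul]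
        gcongr
        exact (Finset.card_le_univ _).trans (by simp)
  have htotal : (8 ^ B) ^ m ≤ ∑ f ∈ X, (ball f).card := by
    calc (8 ^ B) ^ m = (Finset.univ : Finset (Fin m → Fin (8 ^ B))).card := by simp
      _ ≤ (X.biUnion ball).card := Finset.card_le_card fun g _ =>
        Finset.mem_biUnion.2 (hcover g)
      _ ≤ _ := Finset.card_biUnion_le
  have h1 : (8 ^ B) ^ m * 8 ^ m ≤ X.card * (2 ^ m * (8 ^ B) ^ m) := by
    calc _ ≤ (∑ f ∈ X, (ball f).card) * 8 ^ m := by gcongr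
      _ = ∑ f ∈ X, (ball f).card * 8 ^ m := Finset.sum_mul ..
      _ ≤ ∑ f ∈ X, 2 ^ m * (8 ^ B) ^ m := Finset.sum_le_sum fun f _ => hball f
      _ = _ := by simp
  have h2 : (8 : ℕ) ^ m = 2 ^ m * 4 ^ m := by
    rw [← mul_pow]
    norm_num
  rw [h2] at h1
  have h3 : 0 < 2 ^ m * (8 ^ B) ^ m := by positivity
  refine Nat.le_of_mul_le_mul_right ?_ h3
  linarith

/-- An exponentially large family of sets of size `m` with small pairwise intersections. -/
theorem exists_set_family (n m B : ℕ) (hm : 0 < m) (hB : 2 ≤ B) (hn : m * 8 ^ B ≤ n) :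
    ∃ X : Finset (Finset (Fin n)), 4 ^ m ≤ X.card ∧ (∀ x ∈ X, x.card = m) ∧
      ∀ x ∈ X, ∀ y ∈ X, x ≠ y → B * (x ∩ y).card ≤ m := by
  classical
  obtain ⟨X, hX, hcode⟩ := exists_code m B hm hB
  let e : Fin m × Fin (8 ^ B) ↪ Fin n := finProdFinEquiv.toEmbedding.trans (Fin.castLEEmb hn)
  -- Codewords become graphs inside a grid of items, so common items are exactly agreements.
  let graph : (Fin m → Fin (8 ^ B)) → Finset (Fin n) := fun f =>
    Finset.univ.image fun i => e (i, f i)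
  have hinter : ∀ f g, graph f ∩ graph g =
      (Finset.univ.filter fun i => f i = g i).image fun i => e (i, f i) := by
    intro f g
    ext a
    simp only [graph, Finset.mem_inter, Finset.mem_image, Finset.mem_univ, true_and,
      Finset.mem_filter]
    constructor
    · rintro ⟨⟨i, rfl⟩, j, hj⟩
      have := e.injective hj
      simp only [Prod.mk.injEq] at this
      obtain ⟨rfl, h⟩ := this
      exact ⟨j, h.symm, rfl⟩
    · rintro ⟨i, h, rfl⟩
      exact ⟨⟨i, rfl⟩, i, by rw [h]⟩
  have hcardinter : ∀ f g, (graph f ∩ graph g).card =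
      (Finset.univ.filter fun i => f i = g i).card := by
    intro f g
    rw [hinter, Finset.card_image_of_injective]
    intro i j h
    exact (Prod.mk.inj (e.injective h)).1
  have hcard : ∀ f, (graph f).card = m := by
    intro f
    rw [← Finset.inter_self (graph f), hcardinter]
    simp
  have hinj : Function.Injective graph := by
    intro f g h
    have h1 := hcardinter f g
    rw [← h, Finset.inter_self, hcard] at h1
    have h2 : (Finset.univ.filter fun i => f i = g i) = Finset.univ :=
      Finset.eq_univ_of_card _ (by simp [← h1])
    funext i
    have h3 := Finset.mem_univ i
    rw [← h2] at h3
    exact (Finset.mem_filter.1 h3).2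
  refine ⟨X.image graph, by rwa [Finset.card_image_of_injective _ hinj], ?_, ?_⟩
  · intro x hx
    obtain ⟨f, -, rfl⟩ := Finset.mem_image.1 hx
    exact hcard f
  · intro x hx y hy hne
    obtain ⟨f, hf, rfl⟩ := Finset.mem_image.1 hx
    obtain ⟨g, hg, rfl⟩ := Finset.mem_image.1 hy
    rw [hcardinter]
    exact hcode f hf g hg fun h => hne (h ▸ rfl)

/-! ### Construction of protocols -/

namespace ProtocolTree

variable {n : ℕ}

/-- The expectation of functions of the allocation and the payment. -/
noncomputable def outcome (T : ProtocolTree n) (s : Strategy) (f : Finset (Fin n) → ℝ≥0 → ℝ≥0∞) : ℝ≥0∞ :=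
  T.leafExp s fun _ => f

theorem WorstCaseCommLE.mono {T : ProtocolTree n} {d d' : ℝ} (h : T.WorstCaseCommLE d)
    (hd : d ≤ d') : T.WorstCaseCommLE d' := fun s a ha => (h s a ha).trans hd

theorem worstCaseCommLE_of_sub {T : ProtocolTree n} {d : ℝ}
    (h : ∀ b, (T.sub b).WorstCaseCommLE d) : T.WorstCaseCommLE (d + 1) := by
  intro s a ha
  rcases List.eq_nil_or_concat a with rfl | ⟨a, b, rfl⟩
  · have := h true s [] (by simp [reach])
    simp only [List.length_nil, Nat.cast_zero] at this ⊢
    linarith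
  · rw [List.concat_eq_append] at ha ⊢
    rw [reach_append] at ha
    have := h b _ a (right_ne_zero_of_mul ha)
    simpa using this

/-- The tree that consists of a leaf. -/
def single (S : Finset (Fin n)) (q : ℝ≥0) : ProtocolTree n := fun _ => NodeLabel.leaf S q

theorem outcome_single (S : Finset (Fin n)) (q : ℝ≥0) (s : Strategy) :
    (single S q).outcome s = fun f => f S q := by
  funext f
  exact leafExp_of_leaf rfl s _

theorem worstCaseCommLE_single (S : Finset (Fin n)) (q : ℝ≥0) :
    (single S q).WorstCaseCommLE 0 := by
  intro s a ha
  rcases List.eq_nil_or_concat a with rfl | ⟨a, b, rfl⟩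
  · simp
  · rw [List.concat_eq_append, reach_append] at ha
    simp [stepProb, single] at ha

/-- The set of all outcomes available to the buyer is a menu. Buyer nodes unite menus, so trees can
be built without tracking individual strategies. -/
theorem range_outcome_buyer (F : Bool → ProtocolTree n) :
    Set.range (node NodeLabel.buyer F).outcome =
      Set.range (F false).outcome ∪ Set.range (F true).outcome := by
  have key : ∀ s, (node NodeLabel.buyer F).outcome s = (F (s [])).outcome (s.sub (s [])) := by
    intro s
    funext f
    rw [outcome, leafExp_of_buyer (node_nil _ _), sub_node]
    rfl
  ext φ
  constructor
  · rintro ⟨s, rfl⟩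
    rw [key]
    cases h : s []
    · exact Or.inl ⟨_, rfl⟩
    · exact Or.inr ⟨_, rfl⟩
  · rintro (⟨s, rfl⟩ | ⟨s, rfl⟩)
    · exact ⟨Strategy.glue false fun _ => s, by simp [key]⟩
    · exact ⟨Strategy.glue true fun _ => s, by simp [key]⟩

theorem outcome_chance (μ : PMF Bool) (F : Bool → ProtocolTree n) (s : Strategy)
    (f : Finset (Fin n) → ℝ≥0 → ℝ≥0∞) :
    (node (NodeLabel.chance μ) F).outcome s f =
      μ false * (F false).outcome (s.sub false) f + μ true * (F true).outcome (s.sub true) f := by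
  rw [outcome, leafExp_of_chance (node_nil _ _), sub_node, sub_node]
  rfl

theorem exists_split {α : Type*} {A : Finset α} {m : ℕ} (hA : 2 ≤ A.card)
    (hm : A.card ≤ 2 ^ (m + 1)) :
    ∃ B ⊆ A, B.Nonempty ∧ (∃ x ∈ A, x ∉ B) ∧ B.card ≤ 2 ^ m ∧ A.card - B.card ≤ 2 ^ m := by
  obtain ⟨B, hB, hcard⟩ := Finset.exists_subset_card_eq (show A.card / 2 ≤ A.card by omega)
  refine ⟨B, hB, Finset.card_pos.1 (by omega), ?_, by rw [pow_succ] at hm; omega,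
    by rw [pow_succ] at hm; omega⟩
  by_contra! h
  have := Finset.card_le_card (show A ⊆ B from h)
  omega

/-- The buyer announces an element of `A`. -/
theorem exists_announce {α : Type*} (F : α → ProtocolTree n) (d : ℝ) (m : ℕ) (A : Finset α)
    (hA : A.Nonempty) (hm : A.card ≤ 2 ^ m) (hF : ∀ i ∈ A, (F i).WorstCaseCommLE d) :
    ∃ T : ProtocolTree n, T.WorstCaseCommLE (d + m) ∧
      Set.range T.outcome = ⋃ i ∈ A, Set.range (F i).outcome := by
  classical
  induction m generalizing A with
  | zero =>
    obtain ⟨i, rfl⟩ := Finset.card_eq_one.1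
      (le_antisymm (by simpa using hm) (Finset.card_pos.2 hA))
    exact ⟨F i, (hF i (by simp)).mono (by simp), by simp⟩
  | succ m ih =>
    rcases Nat.lt_or_ge A.card 2 with h | h
    · obtain ⟨i, rfl⟩ := Finset.card_eq_one.1
        (le_antisymm (by omega) (Finset.card_pos.2 hA))
      refine ⟨F i, (hF i (by simp)).mono ?_, by simp⟩
      have : (0 : ℝ) ≤ (m + 1 : ℕ) := Nat.cast_nonneg _
      linarith
    · obtain ⟨B, hBA, hB, ⟨x, hxA, hxB⟩, h1, h2⟩ := exists_split h hm
      obtain ⟨T₀, d₀, r₀⟩ := ih B hB h1 fun i hi => hF i (hBA hi)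
      obtain ⟨T₁, d₁, r₁⟩ := ih (A \ B) ⟨x, by simp [hxA, hxB]⟩
        (by rwa [Finset.card_sdiff_of_subset hBA]) fun i hi => hF i (Finset.sdiff_subset hi)
      refine ⟨node NodeLabel.buyer fun b => if b then T₁ else T₀, ?_, ?_⟩
      · rw [Nat.cast_succ, ← add_assoc]
        refine worstCaseCommLE_of_sub fun b => ?_
        rw [sub_node]
        cases b <;> assumption
      · rw [range_outcome_buyer]
        simp only [if_true, Bool.false_eq_true, if_false, r₀, r₁]
        rw [← Finset.set_biUnion_union, Finset.union_sdiff_of_subset hBA]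

/-- Chance draws a uniformly random element of `A`. -/
theorem exists_draw {α : Type*} (F : α → ProtocolTree n) (d : ℝ) (m : ℕ) (A : Finset α)
    (hA : A.Nonempty) (hm : A.card ≤ 2 ^ m) (hF : ∀ i ∈ A, (F i).WorstCaseCommLE d) :
    ∃ T : ProtocolTree n, T.WorstCaseCommLE (d + m) ∧
      ∀ φ, φ ∈ Set.range T.outcome ↔ ∃ σ : α → Strategy,
        φ = fun f => ∑ i ∈ A, (A.card : ℝ≥0∞)⁻¹ * (F i).outcome (σ i) f := by
  classical
  induction m generalizing A with
  | zero =>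
    obtain ⟨i, rfl⟩ := Finset.card_eq_one.1
      (le_antisymm (by simpa using hm) (Finset.card_pos.2 hA))
    refine ⟨F i, (hF i (by simp)).mono (by simp), fun φ => ⟨?_, ?_⟩⟩
    · rintro ⟨s, rfl⟩
      exact ⟨fun _ => s, by simp⟩
    · rintro ⟨σ, rfl⟩
      exact ⟨σ i, by simp⟩
  | succ m ih =>
    rcases Nat.lt_or_ge A.card 2 with h | h
    · obtain ⟨i, rfl⟩ := Finset.card_eq_one.1
        (le_antisymm (by omega) (Finset.card_pos.2 hA))
      refine ⟨F i, (hF i (by simp)).mono ?_, fun φ => ⟨?_, ?_⟩⟩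
      · have : (0 : ℝ) ≤ (m + 1 : ℕ) := Nat.cast_nonneg _
        linarith
      · rintro ⟨s, rfl⟩
        exact ⟨fun _ => s, by simp⟩
      · rintro ⟨σ, rfl⟩
        exact ⟨σ i, by simp⟩
    · obtain ⟨B, hBA, hB, ⟨x, hxA, hxB⟩, h1, h2⟩ := exists_split h hm
      obtain ⟨T₀, d₀, r₀⟩ := ih B hB h1 fun i hi => hF i (hBA hi)
      have hC : (A \ B).Nonempty := ⟨x, by simp [hxA, hxB]⟩
      obtain ⟨T₁, d₁, r₁⟩ := ih (A \ B) hC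
        (by rwa [Finset.card_sdiff_of_subset hBA]) fun i hi => hF i (Finset.sdiff_subset hi)
      have hsum : (B.card : ℝ≥0∞) + (A \ B).card = A.card := by
        rw [add_comm]
        exact_mod_cast Finset.card_sdiff_add_card_eq_card hBA
      have hA0 : (A.card : ℝ≥0∞) ≠ 0 := by simpa using hA.ne_empty
      have hB0 : (B.card : ℝ≥0∞) ≠ 0 := by simpa using hB.ne_empty
      have hC0 : ((A \ B).card : ℝ≥0∞) ≠ 0 := by
        simpa only [ne_eq, Nat.cast_eq_zero, Finset.card_eq_zero] using hC.ne_empty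
      -- The halves may differ in size by one, so chance branches in proportion to their
      -- cardinalities to keep the draw uniform.
      let μ : PMF Bool := PMF.ofFintype
        (fun b => (if b then ((A \ B).card : ℝ≥0∞) else B.card) * (A.card : ℝ≥0∞)⁻¹) (by
          rw [Fintype.sum_bool]
          simp only [if_true, Bool.false_eq_true, if_false]
          rw [← add_mul, add_comm, hsum, ENNReal.mul_inv_cancel hA0 (by simp)])
      have hμ0 : μ false = B.card * (A.card : ℝ≥0∞)⁻¹ := by simp [μ]
      have hμ1 : μ true = (A \ B).card * (A.card : ℝ≥0∞)⁻¹ := by simp [μ]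
      have key : ∀ (σ : α → Strategy) (f : Finset (Fin n) → ℝ≥0 → ℝ≥0∞),
          μ false * (∑ i ∈ B, (B.card : ℝ≥0∞)⁻¹ * (F i).outcome (σ i) f) +
            μ true * (∑ i ∈ A \ B, ((A \ B).card : ℝ≥0∞)⁻¹ * (F i).outcome (σ i) f) =
          ∑ i ∈ A, (A.card : ℝ≥0∞)⁻¹ * (F i).outcome (σ i) f := by
        intro σ f
        rw [hμ0, hμ1]
        simp only [← Finset.mul_sum]
        rw [← Finset.sum_sdiff hBA, mul_add, add_comm]
        congr 1
        · rw [mul_mul_mul_comm, ENNReal.mul_inv_cancel hC0 (by simp), one_mul]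
        · rw [mul_mul_mul_comm, ENNReal.mul_inv_cancel hB0 (by simp), one_mul]
      refine ⟨node (NodeLabel.chance μ) fun b => if b then T₁ else T₀, ?_, fun φ => ⟨?_, ?_⟩⟩
      · rw [Nat.cast_succ, ← add_assoc]
        refine worstCaseCommLE_of_sub fun b => ?_
        rw [sub_node]
        cases b <;> assumption
      · rintro ⟨s, rfl⟩
        obtain ⟨σ₀, h₀⟩ := (r₀ _).1 ⟨s.sub false, rfl⟩
        obtain ⟨σ₁, h₁⟩ := (r₁ _).1 ⟨s.sub true, rfl⟩
        refine ⟨fun i => if i ∈ B then σ₀ i else σ₁ i, ?_⟩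
        funext f
        rw [outcome_chance, ← key]
        simp only [if_true, Bool.false_eq_true, if_false, h₀, h₁]
        congr 2
        · exact Finset.sum_congr rfl fun i hi => by rw [if_pos hi]
        · exact Finset.sum_congr rfl fun i hi => by rw [if_neg (Finset.mem_sdiff.1 hi).2]
      · rintro ⟨σ, rfl⟩
        obtain ⟨s₀, h₀⟩ := (r₀ _).2 ⟨σ, rfl⟩
        obtain ⟨s₁, h₁⟩ := (r₁ _).2 ⟨σ, rfl⟩
        refine ⟨Strategy.glue true fun b => if b then s₁ else s₀, ?_⟩
        funext f
        rw [outcome_chance, ← key]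
        simp only [Strategy.sub_glue, if_true, Bool.false_eq_true, if_false, h₀, h₁]

/-- The buyer either leaves, or announces `x ∈ X`, pays `c x` and receives a random item of `x`. -/
theorem exists_menu (X : Finset (Finset (Fin n))) (hX : ∀ x ∈ X, x.Nonempty)
    (c : Finset (Fin n) → ℝ≥0) :
    ∃ T : ProtocolTree n, T.WorstCaseCommLE (2 * n + 1) ∧
      ∀ φ, φ ∈ Set.range T.outcome ↔ (φ = fun f => f ∅ 0) ∨
        ∃ x ∈ X, φ = fun f => ∑ i ∈ x, (x.card : ℝ≥0∞)⁻¹ * f {i} (c x) := by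
  classical
  have hcardx : ∀ x : Finset (Fin n), x.card ≤ 2 ^ n := fun x =>
    (Finset.card_le_univ x).trans (by simpa using Nat.lt_two_pow_self.le)
  have hdraw : ∀ x : Finset (Fin n), ∃ T : ProtocolTree n, x ∈ X → (T.WorstCaseCommLE n ∧
      Set.range T.outcome = {fun f => ∑ i ∈ x, (x.card : ℝ≥0∞)⁻¹ * f {i} (c x)}) := by
    intro x
    by_cases hx : x ∈ X
    · obtain ⟨T, h1, h2⟩ := exists_draw (fun i => single {i} (c x)) 0 n x (hX x hx) (hcardx x)
        fun i _ => worstCaseCommLE_single _ _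
      refine ⟨T, fun _ => ⟨by rwa [zero_add] at h1, ?_⟩⟩
      ext φ
      rw [h2]
      simp [outcome_single]
    · exact ⟨single ∅ 0, fun h => absurd h hx⟩
  choose R hR using hdraw
  -- The entry `none` is opting out; it accounts for the extra bit in `n + 1`.
  obtain ⟨T, h1, h2⟩ := exists_announce (fun o : Option (Finset (Fin n)) =>
    o.elim (single ∅ 0) R) n (n + 1) X.insertNone ⟨none, by simp⟩ (by
      have := Finset.card_le_univ X
      simp only [Fintype.card_finset, Fintype.card_fin] at this
      rw [Finset.card_insertNone, pow_succ]
      have := Nat.one_le_two_pow (n := n)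
      omega) (by
      intro o ho
      cases o with
      | none => exact (worstCaseCommLE_single _ _).mono (Nat.cast_nonneg n)
      | some x => exact (hR x (by simpa using ho)).1)
  refine ⟨T, h1.mono (by push_cast; linarith), fun φ => ?_⟩
  rw [h2]
  simp only [Set.mem_iUnion]
  constructor
  · rintro ⟨o, ho, hφ⟩
    cases o with
    | none =>
      obtain ⟨s, rfl⟩ := hφ
      exact Or.inl (outcome_single _ _ _)
    | some x =>
      have hx : x ∈ X := by simpa using ho
      refine Or.inr ⟨x, hx, ?_⟩
      have h3 : φ ∈ Set.range (R x).outcome := hφ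
      rwa [(hR x hx).2] at h3
  · rintro (rfl | ⟨x, hx, rfl⟩)
    · exact ⟨none, by simp, fun _ => true, outcome_single _ _ _⟩
    · refine ⟨some x, by simpa using hx, ?_⟩
      simp only [Option.elim, (hR x hx).2, Set.mem_singleton_iff]

/-- Chance draws an index `j < k`, and the buyer announces the `j`-th item of his choice and one of
the payments `p l`. -/
theorem exists_indexed_choice (n k b : ℕ) (hk : 0 < k) (hkn : k ≤ n) (p : Fin (b + 1) → ℝ≥0) :
    ∃ T : ProtocolTree n, T.WorstCaseCommLE (2 * Nat.log 2 n + b + 3 : ℕ) ∧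
      ∀ x : Finset (Fin n), x.card = k → ∀ l, ∃ s,
        T.outcome s = fun f => ∑ i ∈ x, (x.card : ℝ≥0∞)⁻¹ * f {i} (p l) := by
  have hn : n ≤ 2 ^ (Nat.log 2 n + 1) := (Nat.lt_pow_succ_log_self (by norm_num) n).le
  have hb : b + 1 ≤ 2 ^ (b + 1) := Nat.lt_two_pow_self.le
  have : NeZero n := ⟨by omega⟩
  obtain ⟨R, h1, h2⟩ := exists_announce (fun z : Fin n × Fin (b + 1) => single {z.1} (p z.2)) 0
    ((Nat.log 2 n + 1) + (b + 1)) Finset.univ Finset.univ_nonempty (by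
      rw [Finset.card_univ, Fintype.card_prod, Fintype.card_fin, Fintype.card_fin, pow_add]
      exact Nat.mul_le_mul hn hb) fun _ _ => worstCaseCommLE_single _ _
  have : NeZero k := ⟨hk.ne'⟩
  obtain ⟨T, h3, h4⟩ := exists_draw (fun _ : Fin k => R) _ (Nat.log 2 n + 1) Finset.univ
    Finset.univ_nonempty (by simpa using hkn.trans hn) fun _ _ => h1
  refine ⟨T, h3.mono (le_of_eq (by push_cast; ring)), fun x hx l => ?_⟩
  have hstrat : ∀ i : Fin n, ∃ s, R.outcome s = fun f => f {i} (p l) := by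
    intro i
    change _ ∈ Set.range R.outcome
    rw [h2]
    simp only [Set.mem_iUnion]
    exact ⟨(i, l), Finset.mem_univ _, fun _ => true, outcome_single _ _ _⟩
  choose σ hσ using hstrat
  -- Answering index `j` with the `j`-th smallest item of `x` turns a uniform index into a uniform
  -- item of `x`, whatever `x` is.
  obtain ⟨s, hs⟩ := (h4 _).2 ⟨fun j => σ (x.orderEmbOfFin hx j), rfl⟩
  refine ⟨s, hs.trans ?_⟩
  funext f
  simp only [hσ, Finset.card_univ, Fintype.card_fin, hx]
  rw [← Finset.sum_coe_sort x, ← (x.orderIsoOfFin hx).toEquiv.sum_comp]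
  rfl

end ProtocolTree

/-! ### The hard prior -/

theorem PMF.tsum_map_mul {α β : Type*} (p : PMF α) (f : α → β) (g : β → ℝ≥0∞) :
    ∑' b, (p.map f) b * g b = ∑' a, p a * g (f a) := by
  classical
  simp only [PMF.map_apply, ← ENNReal.tsum_mul_right]
  rw [ENNReal.tsum_comm]
  refine tsum_congr fun a => ?_
  rw [tsum_eq_single (f a) fun b hb => by rw [if_neg hb, zero_mul], if_pos rfl]

theorem PMF.tsum_uniformOfFinset_mul {α : Type*} (A : Finset α) (hA : A.Nonempty)
    (g : α → ℝ≥0∞) :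
    ∑' a, PMF.uniformOfFinset A hA a * g a = ∑ a ∈ A, (A.card : ℝ≥0∞)⁻¹ * g a := by
  rw [tsum_eq_sum (s := A) fun a ha => by
    rw [PMF.uniformOfFinset_apply_of_notMem hA ha, zero_mul]]
  exact Finset.sum_congr rfl fun a ha => by rw [PMF.uniformOfFinset_apply_of_mem hA ha]

section HardPrior

variable {n : ℕ}

theorem tsum_hardPrior_mul (X : Finset (Finset (Fin n))) (hX : X.Nonempty)
    (c : Finset (Fin n) → ℝ≥0) (g : BundleValuation n → ℝ≥0∞) :
    ∑' v, hardPrior X hX c v * g v = ∑ x ∈ X, (X.card : ℝ≥0∞)⁻¹ * g (hardValuation x (c x)) := by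
  rw [hardPrior, PMF.tsum_map_mul, PMF.tsum_uniformOfFinset_mul]

theorem mem_support_hardPrior {X : Finset (Finset (Fin n))} {hX : X.Nonempty}
    {c : Finset (Fin n) → ℝ≥0} {v : BundleValuation n} :
    v ∈ (hardPrior X hX c).support ↔ ∃ x ∈ X, hardValuation x (c x) = v := by
  simp [hardPrior]

theorem isUnitDemand_hardValuation (x : Finset (Fin n)) (r : ℝ≥0) :
    IsUnitDemand (hardValuation x r) := by
  refine ⟨fun i => if i ∈ x then r else 0, fun S => ?_⟩
  unfold hardValuation
  split_ifs with h
  · refine (Finset.sup_eq_bot_iff _ _).2 (fun i hi => ?_) |>.symm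
    rw [if_neg fun hx => Finset.notMem_empty i (h ▸ Finset.mem_inter.2 ⟨hx, hi⟩)]
    rfl
  · obtain ⟨i, hi⟩ := Finset.nonempty_iff_ne_empty.2 h
    obtain ⟨hx, hS⟩ := Finset.mem_inter.1 hi
    refine le_antisymm ?_ (Finset.sup_le fun j _ => ?_)
    · calc r = if i ∈ x then r else 0 := (if_pos hx).symm
        _ ≤ _ := Finset.le_sup (f := fun i => if i ∈ x then r else 0) hS
    · split_ifs <;> simp

theorem hasPrecision_hardValuation (x : Finset (Fin n)) {b l : ℕ} (hl : l ≤ b) :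
    HasPrecision b (hardValuation x ((1 / 2) ^ l)) := by
  intro S
  unfold hardValuation
  split_ifs
  · exact ⟨0, by simp, by simp⟩
  · refine ⟨2 ^ (b - l), Nat.pow_le_pow_right (by norm_num) (Nat.sub_le _ _), ?_⟩
    rw [eq_div_iff (by positivity)]
    push_cast
    rw [← Nat.sub_add_cancel hl, pow_add, Nat.add_sub_cancel, mul_comm, mul_assoc, ← mul_pow]
    norm_num

theorem hardValuation_singleton (x : Finset (Fin n)) (r : ℝ≥0) (i : Fin n) :
    hardValuation x r {i} = if i ∈ x then r else 0 := by
  by_cases h : i ∈ x <;> simp [hardValuation, h]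

theorem hardValuation_univ {x : Finset (Fin n)} (hx : x.Nonempty) (r : ℝ≥0) :
    hardValuation x r Finset.univ = r := by
  simp [hardValuation, hx.ne_empty]

theorem wantedItems_hardValuation (x : Finset (Fin n)) {r : ℝ≥0} (hr : r ≠ 0) :
    wantedItems (hardValuation x r) = x := by
  ext i
  simp [wantedItems, hardValuation_singleton, hr]

theorem sum_randomWantedItem_alloc_mul {x : Finset (Fin n)} (hx : x.Nonempty) {r : ℝ≥0}
    (hr : r ≠ 0) (g : Finset (Fin n) → ℝ≥0∞) :
    ∑ S, (randomWantedItem n).alloc (hardValuation x r) S * g S =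
      ∑ i ∈ x, (x.card : ℝ≥0∞)⁻¹ * g {i} := by
  have h : (wantedItems (hardValuation x r)).Nonempty := by rwa [wantedItems_hardValuation x hr]
  rw [← tsum_fintype (L := .unconditional _)]
  simp only [randomWantedItem, dif_pos h]
  rw [PMF.tsum_map_mul, PMF.tsum_uniformOfFinset_mul, wantedItems_hardValuation x hr]

theorem randomWantedItem_pay {x : Finset (Fin n)} (hx : x.Nonempty) (r : ℝ≥0) :
    (randomWantedItem n).pay (hardValuation x r) = r :=
  hardValuation_univ hx r

theorem sum_hardValuation_singleton (x y : Finset (Fin n)) (r : ℝ≥0) :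
    ∑ i ∈ y, (y.card : ℝ≥0∞)⁻¹ * (hardValuation x r {i} : ℝ≥0∞) =
      (y.card : ℝ≥0∞)⁻¹ * ((x ∩ y).card * r) := by
  rw [← Finset.mul_sum]
  congr 1
  simp only [hardValuation_singleton]
  simp only [apply_ite ((↑) : ℝ≥0 → ℝ≥0∞), ENNReal.coe_zero]
  rw [Finset.sum_ite_mem, Finset.sum_const, nsmul_eq_mul, Finset.inter_comm]

theorem sum_hardValuation_singleton_self {x : Finset (Fin n)} (hx : x.Nonempty) (r : ℝ≥0) :
    ∑ i ∈ x, (x.card : ℝ≥0∞)⁻¹ * (hardValuation x r {i} : ℝ≥0∞) = r := by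
  rw [sum_hardValuation_singleton, Finset.inter_self, ← mul_assoc,
    ENNReal.inv_mul_cancel (by simpa using hx.ne_empty) (by simp), one_mul]

/-- This is the incentive constraint: a type `x` that poses as `y` gets a wanted item only with
probability `|x ∩ y| / k`, which is worth no more than the price `c y`. -/
theorem sum_hardValuation_singleton_le {k : ℕ} {X : Finset (Finset (Fin n))}
    {c : Finset (Fin n) → ℝ≥0} (hXk : ∀ x ∈ X, x.card = k)
    (hIC : ∀ x ∈ X, ∀ y ∈ X, c x * (x ∩ y).card ≤ k * c y) {x y : Finset (Fin n)} (hx : x ∈ X)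
    (hy : y ∈ X) :
    ∑ i ∈ y, (y.card : ℝ≥0∞)⁻¹ * (hardValuation x (c x) {i} : ℝ≥0∞) ≤ c y := by
  rw [sum_hardValuation_singleton, hXk y hy, mul_comm, ← ENNReal.div_eq_inv_mul.trans (mul_comm _ _)]
  refine ENNReal.div_le_of_le_mul' ?_
  have := hIC x hx y hy
  rw [mul_comm] at this
  exact_mod_cast this

theorem lotteryValue_hardValuation_le (x : Finset (Fin n)) (r : ℝ≥0)
    (L : PMF (Finset (Fin n))) : lotteryValue (hardValuation x r) L ≤ r := by
  calc lotteryValue (hardValuation x r) L ≤ ∑ S, L S * r := by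
        refine Finset.sum_le_sum fun S _ => mul_le_mul_right ?_ _
        exact_mod_cast hardValuation_le x r S
    _ = r := by
      rw [← Finset.sum_mul, ← tsum_fintype (L := .unconditional _), L.tsum_coe, one_mul]

/-- The data of a hard instance in which no type gains from pretending to be another one. -/
structure IsHardInstance (k : ℕ) (X : Finset (Finset (Fin n))) (c : Finset (Fin n) → ℝ≥0) :
    Prop where
  pos : 0 < k
  card : ∀ x ∈ X, x.card = k
  value_pos : ∀ x ∈ X, 0 < c x
  inter : ∀ x ∈ X, ∀ y ∈ X, c x * (x ∩ y).card ≤ k * c y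

namespace IsHardInstance

variable {k : ℕ} {X : Finset (Finset (Fin n))} {c : Finset (Fin n) → ℝ≥0}

theorem nonempty (h : IsHardInstance k X c) {x : Finset (Fin n)} (hx : x ∈ X) : x.Nonempty :=
  Finset.card_pos.1 ((h.card x hx).symm ▸ h.pos)

theorem isIC (h : IsHardInstance k X c) (hX : X.Nonempty) :
    (randomWantedItem n).IsIC (hardPrior X hX c) := by
  intro v hv v' hv'
  obtain ⟨x, hx, rfl⟩ := mem_support_hardPrior.1 hv
  obtain ⟨y, hy, rfl⟩ := mem_support_hardPrior.1 hv'
  rw [lotteryValue, lotteryValue,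
    sum_randomWantedItem_alloc_mul (h.nonempty hx) (h.value_pos x hx).ne',
    sum_randomWantedItem_alloc_mul (h.nonempty hy) (h.value_pos y hy).ne',
    randomWantedItem_pay (h.nonempty hx), randomWantedItem_pay (h.nonempty hy),
    sum_hardValuation_singleton_self (h.nonempty hx), add_comm]
  gcongr
  exact sum_hardValuation_singleton_le h.card h.inter hx hy

theorem isIR (h : IsHardInstance k X c) (hX : X.Nonempty) :
    (randomWantedItem n).IsIR (hardPrior X hX c) := by
  intro v hv
  obtain ⟨x, hx, rfl⟩ := mem_support_hardPrior.1 hv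
  rw [lotteryValue, sum_randomWantedItem_alloc_mul (h.nonempty hx) (h.value_pos x hx).ne',
    sum_hardValuation_singleton_self (h.nonempty hx), randomWantedItem_pay (h.nonempty hx)]

/-- Each type pays its full value, and individual rationality permits no mechanism to charge more.
-/
theorem isOptimal (h : IsHardInstance k X c) (hX : X.Nonempty) :
    (randomWantedItem n).IsOptimal (hardPrior X hX c) := by
  refine ⟨h.isIC hX, h.isIR hX, le_antisymm (le_iSup₂_of_le _ ⟨h.isIC hX, h.isIR hX⟩ le_rfl) ?_⟩
  refine iSup₂_le fun M hM => ?_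
  rw [DirectMechanism.revenue, DirectMechanism.revenue, tsum_hardPrior_mul, tsum_hardPrior_mul]
  refine Finset.sum_le_sum fun x hx => mul_le_mul_right ?_ _
  rw [randomWantedItem_pay (h.nonempty hx)]
  exact (hM.2 _ (mem_support_hardPrior.2 ⟨x, hx, rfl⟩)).trans
    (lotteryValue_hardValuation_le _ _ _)

theorem optRevenue_eq (h : IsHardInstance k X c) (hX : X.Nonempty) :
    optRevenue (hardPrior X hX c) = ∑ x ∈ X, (X.card : ℝ≥0∞)⁻¹ * (c x : ℝ≥0∞) := by
  rw [← (h.isOptimal hX).2.2, DirectMechanism.revenue, tsum_hardPrior_mul]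
  exact Finset.sum_congr rfl fun x hx => by rw [randomWantedItem_pay (h.nonempty hx)]

theorem implements_of_outcome (h : IsHardInstance k X c) (hX : X.Nonempty) {P : AuctionProtocol n}
    (hP : ∀ x ∈ X, P.tree.outcome (P.suggested (hardValuation x (c x))) =
      fun f => ∑ i ∈ x, (x.card : ℝ≥0∞)⁻¹ * f {i} (c x)) :
    P.Implements (hardPrior X hX c) (randomWantedItem n) := by
  intro v hv
  obtain ⟨x, hx, rfl⟩ := mem_support_hardPrior.1 hv
  constructor
  · intro S
    have h1 : P.tree.allocProb (P.suggested (hardValuation x (c x))) S = _ :=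
      congrFun (hP x hx) fun S' _ => if S' = S then 1 else 0
    rw [h1, ← sum_randomWantedItem_alloc_mul (h.nonempty hx) (h.value_pos x hx).ne'
      fun S' => if S' = S then 1 else 0]
    simp
  · have h1 : P.tree.expPay (P.suggested (hardValuation x (c x))) = _ :=
      congrFun (hP x hx) fun _ q => (q : ℝ≥0∞)
    rw [h1, randomWantedItem_pay (h.nonempty hx), Finset.sum_const, nsmul_eq_mul, ← mul_assoc,
      ENNReal.mul_inv_cancel (by simpa using (h.nonempty hx).ne_empty) (by simp), one_mul]

/-- A suggested strategy for each type can be assembled from strategies for the sets in `X`. -/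
theorem exists_suggested (h : IsHardInstance k X c) {Q : Finset (Fin n) → Strategy → Prop}
    (hQ : ∀ x ∈ X, ∃ s, Q x s) :
    ∃ σ : BundleValuation n → Strategy, ∀ x ∈ X, Q x (σ (hardValuation x (c x))) := by
  choose! σ hσ using hQ
  refine ⟨fun v => σ (wantedItems v), fun x hx => ?_⟩
  simp only [wantedItems_hardValuation x (h.value_pos x hx).ne']
  exact hσ x hx

/-- Every strategy amounts to opting out or to buying one menu entry, none of which gives positive
utility; the truthful entry gives exactly zero. -/
theorem exists_isIC_protocol (h : IsHardInstance k X c) (hX : X.Nonempty) :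
    ∃ P : AuctionProtocol n, P.IsIC (hardPrior X hX c) ∧
      P.Implements (hardPrior X hX c) (randomWantedItem n) ∧
      P.tree.WorstCaseCommLE (2 * n + 1) := by
  obtain ⟨T, hcomm, hT⟩ := ProtocolTree.exists_menu X (fun x hx => h.nonempty hx) c
  obtain ⟨σ, hσ⟩ := h.exists_suggested (Q := fun x s => T.outcome s =
    fun f => ∑ i ∈ x, (x.card : ℝ≥0∞)⁻¹ * f {i} (c x))
    fun x hx => (hT _).2 (Or.inr ⟨x, hx, rfl⟩)
  have hinv : ∀ x ∈ X, (x.card : ℝ≥0∞) * (x.card : ℝ≥0∞)⁻¹ = 1 := fun x hx =>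
    ENNReal.mul_inv_cancel (by simpa using (h.nonempty hx).ne_empty) (by simp)
  have hval : ∀ s v, T.expValue s v = T.outcome s fun S _ => (v S : ℝ≥0∞) := fun _ _ => rfl
  have hpay : ∀ s, T.expPay s = T.outcome s fun _ q => (q : ℝ≥0∞) := fun _ => rfl
  refine ⟨⟨T, σ⟩, ⟨?_, ?_, ?_⟩, h.implements_of_outcome hX hσ, hcomm⟩
  · intro s
    change T.outcome s (fun _ _ => 1) = 1
    rcases (hT _).1 ⟨s, rfl⟩ with h1 | ⟨x, hx, h1⟩
    · rw [h1]
    · rw [h1]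
      simp [hinv x hx]
  · obtain ⟨s, hs⟩ := (hT _).2 (Or.inl rfl)
    refine ⟨s, ?_, ?_⟩
    · simp only [hpay, hs, ENNReal.coe_zero]
    · change T.outcome s (fun S' _ => if S' = ∅ then 1 else 0) = 1
      simp only [hs, if_true]
  · intro v hv s
    obtain ⟨x, hx, rfl⟩ := mem_support_hardPrior.1 hv
    simp only [hval, hpay, hσ x hx, ENNReal.coe_zero, add_zero]
    rw [sum_hardValuation_singleton_self (h.nonempty hx), Finset.sum_const, nsmul_eq_mul,
      ← mul_assoc, hinv x hx, one_mul, add_comm]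
    gcongr
    rcases (hT _).1 ⟨s, rfl⟩ with h1 | ⟨y, hy, h1⟩
    · rw [h1]
      simp [hardValuation]
    · rw [h1]
      simp only
      rw [Finset.sum_const, nsmul_eq_mul, ← mul_assoc, hinv y hy, one_mul]
      exact sum_hardValuation_singleton_le h.card h.inter hx hy

/-- The buyer never describes `x`, only one item and one of `b + 1` prices. Honesty about both is
assumed, not enforced. -/
theorem exists_short_protocol (h : IsHardInstance k X c) (hX : X.Nonempty) {b : ℕ}
    (hc : ∀ x, ∃ l : Fin (b + 1), c x = (1 / 2) ^ (l : ℕ)) :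
    ∃ P : AuctionProtocol n, P.Implements (hardPrior X hX c) (randomWantedItem n) ∧
      P.tree.WorstCaseCommLE (2 * Nat.log 2 n + b + 3 : ℕ) := by
  have hkn : k ≤ n := by
    obtain ⟨x, hx⟩ := hX
    rw [← h.card x hx]
    simpa using Finset.card_le_univ x
  obtain ⟨T, hcomm, hT⟩ := ProtocolTree.exists_indexed_choice n k b h.pos hkn
    fun l => (1 / 2) ^ (l : ℕ)
  obtain ⟨σ, hσ⟩ := h.exists_suggested (Q := fun x s => T.outcome s =
    fun f => ∑ i ∈ x, (x.card : ℝ≥0∞)⁻¹ * f {i} (c x)) fun x hx => by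
      obtain ⟨l, hl⟩ := hc x
      rw [hl]
      exact hT x (h.card x hx) l
  exact ⟨⟨T, σ⟩, h.implements_of_outcome hX hσ, hcomm⟩

end IsHardInstance

/-- Revenue and communication of an approximately IC protocol, in terms of a surplus function. -/
theorem exists_surplus_revenue_bound {X : Finset (Finset (Fin n))} (hX : X.Nonempty)
    {c : Finset (Fin n) → ℝ≥0} (hc : ∀ x ∈ X, c x ≤ 1) {P : AuctionProtocol n} {ε : ℝ≥0}
    (hP : P.IsApproxIC (hardPrior X hX c) ε) {d : ℕ} (hd : d ≠ 0) :
    ∃ h, IsSurplus d h ∧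
      ∑ x ∈ X, 2 * (h x (c x) : ℝ≥0∞) + X.card * P.revenue (hardPrior X hX c) ≤
        ∑ x ∈ X, (h x (2 * c x) : ℝ≥0∞) +
          2 * (X.card * P.exAnteComm (hardPrior X hX c) / d) + X.card * (2 * ε) := by
  obtain ⟨hfin, hIR, hIC⟩ := hP
  obtain ⟨h, hh, hb⟩ := ProtocolTree.exists_surplus_bound hfin hIR hd
  refine ⟨h, hh, ?_⟩
  have hinv : (X.card : ℝ≥0∞) * (X.card : ℝ≥0∞)⁻¹ = 1 :=
    ENNReal.mul_inv_cancel (by simpa using hX.ne_empty) (by simp)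
  have hmul : ∀ g : BundleValuation n → ℝ≥0∞, X.card * ∑' v, hardPrior X hX c v * g v =
      ∑ x ∈ X, g (hardValuation x (c x)) := fun g => by
    rw [tsum_hardPrior_mul, ← Finset.mul_sum, ← mul_assoc, hinv, one_mul]
  rw [AuctionProtocol.revenue, AuctionProtocol.exAnteComm, hmul, hmul,
    ← Finset.sum_add_distrib, div_eq_mul_inv, Finset.sum_mul, Finset.mul_sum,
    ← Finset.sum_add_distrib, ← nsmul_eq_mul, ← Finset.sum_const, ← Finset.sum_add_distrib]
  refine Finset.sum_le_sum fun x hx => ?_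
  exact hb x (c x) ε _ (hc x hx) (hIC _ (mem_support_hardPrior.2 ⟨x, hx, rfl⟩))

end HardPrior

/-! ### The choice of the values -/

/-- Doubling `(1 / 2) ^ (j + 1)` gives `(1 / 2) ^ j`, so the weights `2 ^ j` make the sum telescope;
only the first term, at most `h x 2 ≤ 2`, counts. -/
theorem sum_two_pow_mul_surplus_le {n d : ℕ} {h : Finset (Fin n) → ℝ≥0 → ℝ≥0}
    (hh : IsSurplus d h) (x : Finset (Fin n)) (b : ℕ) :
    ∑ j ∈ Finset.range b, (2 : ℝ) ^ j *
      ((h x (2 * (1 / 2) ^ j) : ℝ) - 2 * h x ((1 / 2) ^ j)) ≤ 2 := by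
  have h1 : ∀ j : ℕ, (2 : ℝ) ^ j * ((h x (2 * (1 / 2) ^ j) : ℝ) - 2 * h x ((1 / 2) ^ j)) =
      2 ^ j * (h x (2 * (1 / 2) ^ j) : ℝ) - 2 ^ (j + 1) * (h x (2 * (1 / 2) ^ (j + 1)) : ℝ) := by
    intro j
    have : (2 : ℝ≥0) * (1 / 2) ^ (j + 1) = (1 / 2) ^ j := by
      rw [pow_succ]
      field_simp
    rw [this]
    ring
  simp only [h1]
  rw [Finset.sum_range_sub' (fun j => (2 : ℝ) ^ j * (h x (2 * (1 / 2) ^ j) : ℝ))]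
  have h2 : (h x (2 * (1 / 2) ^ 0) : ℝ) ≤ 2 := by
    have := hh.le x (2 * (1 / 2) ^ 0)
    simp only [pow_zero, mul_one] at this ⊢
    exact_mod_cast this
  have h3 : (0 : ℝ) ≤ 2 ^ b * (h x (2 * (1 / 2) ^ b) : ℝ) := by positivity
  rw [pow_zero, one_mul]
  linarith

/-- Some choice of values is bad for all surplus functions of depth `d`. -/
theorem exists_values {n : ℕ} (b d M W : ℕ) (hW : W = ∑ j ∈ Finset.range (b + 1), 2 ^ j)
    (hM : M ≠ 0) (X : Finset (Finset (Fin n))) {s : ℝ} (hs0 : 0 ≤ s) (hs : s ≤ 4)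
    (hcard : ((5 * M * 2 ^ n : ℕ) : ℝ) ^ (2 ^ d) < Real.exp (X.card * s ^ 2 / 16)) :
    ∃ c : Finset (Fin n) → ℝ≥0, (∀ x, ∃ l : Fin (b + 1), c x = (1 / 2) ^ (l : ℕ)) ∧
      X.card * ((b + 1) / W - s) ≤ ∑ x ∈ X, (c x : ℝ) ∧
      ∀ h, IsSurplus d h → ∑ x ∈ X, ((h x (2 * c x) : ℝ) - 2 * h x (c x)) ≤
        X.card * (2 / W + s + 6 * d / M) := by
  classical
  obtain ⟨N, hfin, hN, hNcard, happ⟩ := exists_surplus_net n M hM d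
  have hW0 : (0 : ℝ) < W := by
    rw [hW]
    push_cast
    exact Finset.sum_pos (fun _ _ => by positivity) ⟨0, by simp⟩
  let lev : Fin (b + 1) → ℝ≥0 := fun j => (1 / 2) ^ (j : ℕ)
  have hlev : ∀ j, lev j ≤ 1 := fun j => pow_le_one₀ (by positivity)
    (by rw [div_le_one (by norm_num)]; norm_num)
  let w : Fin (b + 1) → ℝ := fun j => 2 ^ (j : ℕ) / W
  have hw1 : ∑ j, w j = 1 := by
    simp only [w]
    rw [← Finset.sum_div, Fin.sum_univ_eq_sum_range (fun j => (2 : ℝ) ^ j) (b + 1),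
      div_eq_one_iff_eq hW0.ne', hW]
    push_cast
    rfl
  -- The index `none` puts the lower bound on `∑ c x` into the same union bound as the net.
  let g : Option (Finset (Fin n) → ℝ≥0 → ℝ≥0) → X → Fin (b + 1) → ℝ := fun a x j =>
    a.elim (-(lev j : ℝ)) fun h => (h x (2 * lev j) : ℝ) - 2 * h x (lev j)
  let μ : Option (Finset (Fin n) → ℝ≥0 → ℝ≥0) → ℝ := fun a =>
    a.elim (-((b + 1) / W)) fun _ => 2 / W
  obtain ⟨φ, hφ⟩ := exists_choice_forall_sum_le w (fun j => by positivity) hw1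
    hfin.toFinset.insertNone g μ hs0 hs (by
      intro a ha x j
      have hl : (lev j : ℝ) ≤ 1 := by exact_mod_cast hlev j
      have hl0 : (0 : ℝ) ≤ lev j := (lev j).2
      cases a with
      | none =>
        simp only [g, Option.elim, abs_neg]
        rw [abs_of_nonneg hl0]
        linarith
      | some h =>
        have hh : IsSurplus d h := hN h (by simpa using ha)
        have h1 : (h x (2 * lev j) : ℝ) ≤ 2 * lev j := by exact_mod_cast hh.le x (2 * lev j)
        have h2 : (h x (lev j) : ℝ) ≤ lev j := by exact_mod_cast hh.le x (lev j)
        have h3 : (0 : ℝ) ≤ h x (2 * lev j) := NNReal.coe_nonneg _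
        have h4 : (0 : ℝ) ≤ h x (lev j) := NNReal.coe_nonneg _
        simp only [g, Option.elim]
        rw [abs_le]
        constructor <;> linarith) (by
      intro a ha x
      cases a with
      | none =>
        simp only [g, μ, w, lev, Option.elim]
        refine le_of_eq ?_
        have : ∀ j : Fin (b + 1), (2 : ℝ) ^ (j : ℕ) / W * -(((1 / 2) ^ (j : ℕ) : ℝ≥0) : ℝ) =
            -(1 / W) := by
          intro j
          push_cast
          rw [one_div_pow]
          field_simp
        rw [Finset.sum_congr rfl fun j _ => this j]
        simp
        ring
      | some h =>
        have hh : IsSurplus d h := hN h (by simpa using ha)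
        simp only [g, μ, w, lev, Option.elim]
        have h1 := sum_two_pow_mul_surplus_le hh x (b + 1)
        rw [← Fin.sum_univ_eq_sum_range (fun j : ℕ => (2 : ℝ) ^ j *
          ((h x (2 * (1 / 2) ^ j) : ℝ) - 2 * h x ((1 / 2) ^ j)))] at h1
        simp only [div_mul_eq_mul_div]
        rw [← Finset.sum_div]
        exact div_le_div_of_nonneg_right h1 hW0.le) (by
      rw [Finset.card_insertNone, ← Set.ncard_eq_toFinset_card N hfin, Real.exp_neg,
        ← div_eq_mul_inv, div_lt_one (Real.exp_pos _), Fintype.card_coe]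
      refine lt_of_le_of_lt ?_ hcard
      rw [← Nat.cast_pow]
      refine Nat.cast_le.2 ?_
      have h5 : 5 ≤ 5 * M * 2 ^ n := by
        have := Nat.one_le_two_pow (n := n)
        have : 1 ≤ M := Nat.one_le_iff_ne_zero.2 hM
        nlinarith
      have h6 : 5 * M * 2 ^ n ≤ (5 * M * 2 ^ n) ^ 2 ^ d :=
        Nat.le_self_pow (by positivity) _
      have h7 : N.ncard * 5 ≤ N.ncard * (5 * M) := by
        gcongr
        omega
      omega)
  let c : Finset (Fin n) → ℝ≥0 := fun x => if h : x ∈ X then lev (φ ⟨x, h⟩) else 1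
  have hcX : ∀ x : X, c x = lev (φ x) := fun x => by simp [c]
  have hc1 : ∀ x, c x ≤ 1 := fun x => by
    simp only [c]
    split_ifs
    · exact hlev _
    · exact le_rfl
  refine ⟨c, fun x => ?_, ?_, fun h hh => ?_⟩
  · simp only [c]
    split_ifs with hx
    · exact ⟨_, rfl⟩
    · exact ⟨0, by simp⟩
  · have h1 := hφ none (by simp)
    simp only [g, μ, Option.elim, Fintype.card_coe, Finset.sum_neg_distrib] at h1
    rw [← Finset.sum_coe_sort X]
    simp only [hcX]
    linarith
  · obtain ⟨h', hN', hd⟩ := happ h hh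
    have h1 := hφ (some h') (by simpa using hN')
    simp only [g, μ, Option.elim, Fintype.card_coe] at h1
    -- The net error `2 * d / M` enters three times: once at `2 * c x` and twice at `c x`.
    have h2 : ∀ x ∈ X, (h x (2 * c x) : ℝ) - 2 * h x (c x) ≤
        ((h' x (2 * c x) : ℝ) - 2 * h' x (c x)) + 6 * d / M := by
      intro x _
      have k1 := abs_le.1 (hd x (2 * c x) (mul_le_of_le_one_right' (hc1 x)))
      have k2 := abs_le.1 (hd x (c x) ((hc1 x).trans (by norm_num)))
      have k3 : (6 * d / M : ℝ) = 3 * (2 * d / M) := by ring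
      rw [k3]
      linarith [k1.2, k2.1]
    refine (Finset.sum_le_sum h2).trans ?_
    rw [Finset.sum_add_distrib, Finset.sum_const, nsmul_eq_mul, ← Finset.sum_coe_sort X]
    simp only [hcX]
    linarith

/-! ### The communication lower bound -/

/-- If the communication were below `d / (8 * W)`, the truncation error would be at most `2 / (8 *
W)`, and the average revenue at most `3 / W`. But it is at least `τ * b / W > 3 / W`. -/
theorem IsHardInstance.le_exAnteComm {n k : ℕ} {X : Finset (Finset (Fin n))}
    {c : Finset (Fin n) → ℝ≥0} (h : IsHardInstance k X c) (hX : X.Nonempty)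
    (hc : ∀ x ∈ X, c x ≤ 1) {b d W : ℕ} (hd : d ≠ 0) (hW : W ≠ 0) {τ : ℝ≥0}
    (hτ : 3 < τ * b) (hsum : X.card * (b / W : ℝ) ≤ ∑ x ∈ X, (c x : ℝ))
    (hsur : ∀ h, IsSurplus d h → ∑ x ∈ X, ((h x (2 * c x) : ℝ) - 2 * h x (c x)) ≤
      X.card * (5 / 2 / W : ℝ))
    {P : AuctionProtocol n} (hP : P.IsApproxIC (hardPrior X hX c) (1 / (8 * W)))
    (hrev : (τ : ℝ≥0∞) * optRevenue (hardPrior X hX c) ≤ P.revenue (hardPrior X hX c))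
    {y : ℝ≥0} (hy : y ≤ 1 / (8 * W) * d) :
    (y : ℝ≥0∞) ≤ P.exAnteComm (hardPrior X hX c) := by
  by_contra! hlt
  obtain ⟨u, hu, hbound⟩ := exists_surplus_revenue_bound hX hc hP hd
  have hinv : (X.card : ℝ≥0∞) * (X.card : ℝ≥0∞)⁻¹ = 1 :=
    ENNReal.mul_inv_cancel (by simpa using hX.ne_empty) (by simp)
  have hopt : (X.card : ℝ≥0∞) * optRevenue (hardPrior X hX c) = ∑ x ∈ X, (c x : ℝ≥0∞) := by
    rw [h.optRevenue_eq hX, ← Finset.mul_sum, ← mul_assoc, hinv, one_mul]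
  set e : ℝ≥0 := 1 / (8 * W) with he
  have hE : (X.card : ℝ≥0∞) * P.exAnteComm (hardPrior X hX c) / d ≤ X.card * e := by
    refine ENNReal.div_le_of_le_mul ?_
    rw [mul_assoc]
    refine mul_le_mul_right (hlt.le.trans ?_) _
    exact_mod_cast hy
  have h1 : ∑ x ∈ X, 2 * (u x (c x) : ℝ≥0∞) + τ * ∑ x ∈ X, (c x : ℝ≥0∞) ≤
      ∑ x ∈ X, (u x (2 * c x) : ℝ≥0∞) + 2 * (X.card * e) + X.card * (2 * e) := by
    calc _ = ∑ x ∈ X, 2 * (u x (c x) : ℝ≥0∞) +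
          X.card * (τ * optRevenue (hardPrior X hX c)) := by
          rw [← hopt, mul_left_comm]
      _ ≤ _ := by gcongr
      _ ≤ _ := hbound
      _ ≤ _ := by gcongr
  have h2 : ∑ x ∈ X, 2 * (u x (c x) : ℝ) + τ * ∑ x ∈ X, (c x : ℝ) ≤
      ∑ x ∈ X, (u x (2 * c x) : ℝ) + 2 * (X.card * e) + X.card * (2 * e) := by
    exact_mod_cast h1
  have h3 := hsur u hu
  rw [Finset.sum_sub_distrib] at h3
  have hWpos : (0 : ℝ) < W := by positivity
  have hN : (0 : ℝ) < X.card := by exact_mod_cast hX.card_pos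
  have he' : (e : ℝ) = 1 / (8 * W) := by
    rw [he]
    push_cast
    rfl
  rw [he'] at h2
  have h4 := mul_le_mul_of_nonneg_left hsum (NNReal.coe_nonneg τ)
  -- The budget is `5/2 + 1/4 + 1/4 = 3`, in units of `1 / W`: surplus, truncation, and `ε`.
  have h5 : (τ : ℝ) * (X.card * (b / W)) ≤ X.card * (3 / W) := by
    have : (X.card : ℝ) * (3 / W) = X.card * (5 / 2 / W) + 2 * (X.card * (1 / (8 * W))) +
        X.card * (2 * (1 / (8 * W))) := by
      field_simp
      norm_num
    rw [this]
    linarith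
  have h6 : (3 : ℝ) < τ * b := by exact_mod_cast hτ
  have h7 : (τ : ℝ) * (X.card * (b / W)) = (τ * b) * (X.card / W) := by ring
  have h8 : (X.card : ℝ) * (3 / W) = 3 * (X.card / W) := by ring
  rw [h7, h8] at h5
  have := lt_of_mul_lt_mul_right (lt_of_lt_of_le (mul_lt_mul_of_pos_right h6
    (by positivity : (0 : ℝ) < X.card / W)) h5) (by positivity)
  exact lt_irrefl _ this

/-! ### Numerical estimates and the choice of the parameters. -/

theorem mul_lt_two_pow {A m : ℕ} (h : A + 4 ≤ m) : A * m < 2 ^ m := by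
  have hsq : ∀ m, 4 ≤ m → m * m ≤ 2 ^ m := by
    intro m hm
    induction m, hm using Nat.le_induction with
    | base => norm_num
    | succ m hm ih =>
      rw [pow_succ]
      nlinarith
  calc A * m < m * m := Nat.mul_lt_mul_of_pos_right (by omega) (by omega)
    _ ≤ 2 ^ m := hsq m (by omega)

/-- The logarithm of the left side is at most `2 ^ m` times a linear function of `m`, whereas `N ≥ 2
^ m * 2 ^ m`; the second factor beats the linear function and the constant `256 * W ^ 2`. -/
theorem net_card_lt_exp {n m q W N : ℕ} (hW : W ≠ 0) (hn : n ≤ 2 * q * m)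
    (hm : 256 * W ^ 2 * (120 * W + 2 * q) + 4 ≤ m) (hN : 4 ^ m ≤ N) :
    ((5 * (24 * m * W) * 2 ^ n : ℕ) : ℝ) ^ (2 ^ m) <
      Real.exp (N * (1 / (4 * W) : ℝ) ^ 2 / 16) := by
  have hWpos : (0 : ℝ) < W := by positivity
  have h1 : ((5 * (24 * m * W) * 2 ^ n : ℕ) : ℝ) ≤ Real.exp (120 * m * W + n) := by
    rw [Real.exp_add]
    push_cast
    have h2 : (2 : ℝ) ^ n ≤ Real.exp n := by
      rw [← Real.exp_one_pow]
      gcongr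
      have := Real.add_one_le_exp (1 : ℝ)
      linarith
    have h3 : (5 * (24 * m * W) : ℝ) ≤ Real.exp (120 * m * W) := by
      have := Real.add_one_le_exp (120 * m * W : ℝ)
      linarith
    gcongr
  have h2 := mul_lt_two_pow hm
  have h3 : ((256 * W ^ 2 * (120 * W + 2 * q) * m : ℕ) : ℝ) < 2 ^ m := by exact_mod_cast h2
  push_cast at h3
  have hn' : (n : ℝ) ≤ 2 * q * m := by exact_mod_cast hn
  have hN' : (2 : ℝ) ^ m * 2 ^ m ≤ N := by
    rw [← mul_pow]
    norm_num
    exact_mod_cast hN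
  calc _ ≤ Real.exp (120 * m * W + n) ^ (2 ^ m) := by gcongr
    _ = Real.exp (2 ^ m * (120 * m * W + n)) := by
      rw [← Real.exp_nat_mul]
      push_cast
      rfl
    _ < _ := by
      refine Real.exp_lt_exp.2 ?_
      have h4 : (N : ℝ) * (1 / (4 * W)) ^ 2 / 16 = N / (256 * W ^ 2) := by
        field_simp
        ring
      rw [h4, lt_div_iff₀ (by positivity)]
      calc (2 : ℝ) ^ m * (120 * m * W + n) * (256 * (W : ℝ) ^ 2)
          ≤ (2 : ℝ) ^ m * (120 * m * W + 2 * q * m) * (256 * (W : ℝ) ^ 2) := by gcongr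
        _ = (2 : ℝ) ^ m * (256 * (W : ℝ) ^ 2 * (120 * W + 2 * q) * m) := by ring
        _ < (2 : ℝ) ^ m * 2 ^ m := by gcongr
        _ ≤ (N : ℝ) := hN'

theorem log_bound {n b : ℕ} (hn : 3 ≤ n) :
    ((2 * Nat.log 2 n + b + 3 : ℕ) : ℝ) ≤ (b + 7 : ℕ) * Real.log n := by
  have hn0 : (3 : ℝ) ≤ n := by exact_mod_cast hn
  have h1 : 1 ≤ Real.log n := by
    rw [Real.le_log_iff_exp_le (by linarith)]
    have := Real.exp_one_lt_d9
    linarith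
  have h2 : (Nat.log 2 n : ℝ) * Real.log 2 ≤ Real.log n := by
    rw [← Real.log_pow]
    refine Real.log_le_log (by positivity) ?_
    exact_mod_cast Nat.pow_log_le_self 2 (by omega)
  have h3 : (1 / 2 : ℝ) ≤ Real.log 2 := by
    have := Real.log_two_gt_d9
    linarith
  have h4 : (Nat.log 2 n : ℝ) ≤ 2 * Real.log n := by
    nlinarith [Nat.cast_nonneg (α := ℝ) (Nat.log 2 n)]
  push_cast
  nlinarith [Nat.cast_nonneg (α := ℝ) b]

theorem mainTheorem7 (τ : ℝ≥0) (hτ : 0 < τ) :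
    ∃ (b n₀ : ℕ) (ε κ : ℝ≥0) (C : ℝ), 0 < ε ∧ 0 < κ ∧
      ∀ n : ℕ, n₀ ≤ n →
        ∃ (k : ℕ) (X : Finset (Finset (Fin n))) (hX : X.Nonempty) (c : Finset (Fin n) → ℝ≥0),
          -- a hard instance: sets of equal positive size, positive values
          0 < k ∧ (∀ x ∈ X, x.card = k) ∧ (∀ x ∈ X, 0 < c x) ∧
          -- the valuations are unit-demand and have constant precision
          (∀ v ∈ (hardPrior X hX c).support, IsUnitDemand v ∧ HasPrecision b v) ∧
          -- an optimal mechanism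
          (randomWantedItem n).IsOptimal (hardPrior X hX c) ∧
          -- it has an exactly incentive compatible implementation with `O(n)` communication
          (∃ P : AuctionProtocol n, P.IsIC (hardPrior X hX c) ∧
            P.Implements (hardPrior X hX c) (randomWantedItem n) ∧
            P.tree.WorstCaseCommLE (C * n)) ∧
          -- it has a (non-IC) implementation with `O(log n)` communication
          (∃ P : AuctionProtocol n,
            P.Implements (hardPrior X hX c) (randomWantedItem n) ∧
            P.tree.WorstCaseCommLE (C * Real.log n)) ∧
          -- approximately IC and approximately optimal protocols need `Ω(n)` communication
          (∀ P : AuctionProtocol n, P.IsApproxIC (hardPrior X hX c) ε →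
            (τ : ℝ≥0∞) * optRevenue (hardPrior X hX c) ≤ P.revenue (hardPrior X hX c) →
            ((κ * n : ℝ≥0) : ℝ≥0∞) ≤ P.exAnteComm (hardPrior X hX c)) := by
  obtain ⟨b, hb⟩ : ∃ b : ℕ, 3 < τ * b := by
    obtain ⟨b, hb⟩ := exists_nat_gt (3 / τ)
    exact ⟨b, by rwa [div_lt_iff₀' hτ] at hb⟩
  have hb0 : b ≠ 0 := by
    rintro rfl
    simp at hb
  set W := ∑ j ∈ Finset.range (b + 1), 2 ^ j with hW
  have hW0 : W ≠ 0 := (Finset.sum_pos (fun _ _ => by positivity) ⟨0, by simp⟩).ne'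
  -- The alphabet size for `B = 2 ^ b`. This `B` is the largest possible ratio of two values, so
  -- intersections of size at most `m / B` make the incentive constraints hold.
  set q := 8 ^ 2 ^ b with hq
  have hq8 : 8 ≤ q := Nat.le_self_pow (by positivity) 8
  refine ⟨b, q * (256 * W ^ 2 * (120 * W + 2 * q) + 4), 1 / (8 * W), 1 / (8 * W) / (2 * q),
    (b + 7 : ℕ), by positivity, by positivity, fun n hn => ?_⟩
  set m := n / q with hmdef
  have hm : 256 * W ^ 2 * (120 * W + 2 * q) + 4 ≤ m := (Nat.le_div_iff_mul_le (by omega)).2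
    (by rwa [mul_comm])
  have hm0 : 0 < m := by omega
  have hmn : m * q ≤ n := Nat.div_mul_le_self n q
  have hnm : n ≤ 2 * q * m := by
    have h1 : n < q * (m + 1) := Nat.lt_mul_div_succ n (by omega)
    nlinarith
  have hn3 : 3 ≤ n := by nlinarith
  obtain ⟨X, hXcard, hXm, hXinter⟩ := exists_set_family n m (2 ^ b) hm0
    (Nat.le_self_pow hb0 2) hmn
  have hX : X.Nonempty := Finset.card_pos.1 (lt_of_lt_of_le (by positivity) hXcard)
  have hWpos : (0 : ℝ) < W := by positivity
  have hW1 : (1 : ℝ) ≤ W := by exact_mod_cast Nat.one_le_iff_ne_zero.2 hW0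
  -- With `d = m` and `M = 24 * m * W` the net error `6 * d / M` equals `1 / (4 * W) = s`, and `2 /
  -- W + s + s = 5 / 2 / W`.
  obtain ⟨c, hc, hsum, hsur⟩ := exists_values b m (24 * m * W) W hW (by positivity) X
    (s := 1 / (4 * W)) (by positivity)
    (by rw [div_le_iff₀ (by positivity)]; linarith) (net_card_lt_exp hW0 hnm hm hXcard)
  have hc0 : ∀ x, 0 < c x := fun x => by
    obtain ⟨l, hl⟩ := hc x
    rw [hl]
    positivity
  have hc1 : ∀ x, c x ≤ 1 := fun x => by
    obtain ⟨l, hl⟩ := hc x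
    rw [hl]
    exact pow_le_one₀ (by positivity) (by rw [div_le_one (by norm_num)]; norm_num)
  have hcb : ∀ y, 1 ≤ 2 ^ b * c y := fun y => by
    obtain ⟨l, hl⟩ := hc y
    have h1 : (2 : ℝ≥0) ^ (l : ℕ) ≤ 2 ^ b := pow_le_pow_right₀ (by norm_num) (by omega)
    calc (1 : ℝ≥0) = 2 ^ (l : ℕ) * (1 / 2) ^ (l : ℕ) := by
          rw [← mul_pow]
          norm_num
      _ ≤ 2 ^ b * c y := by
        rw [hl]
        gcongr
  have hinst : IsHardInstance m X c := by
    refine ⟨hm0, hXm, fun x _ => hc0 x, fun x hx y hy => ?_⟩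
    rcases eq_or_ne x y with rfl | hne
    · rw [Finset.inter_self, hXm x hx, mul_comm]
    · have h1 : ((2 : ℝ≥0) ^ b * (x ∩ y).card) ≤ m := by exact_mod_cast hXinter x hx y hy hne
      calc c x * ((x ∩ y).card : ℝ≥0) ≤ 1 * (x ∩ y).card := by
            gcongr
            exact hc1 x
        _ ≤ (2 ^ b * c y) * (x ∩ y).card := by
          gcongr
          exact hcb y
        _ = (2 ^ b * (x ∩ y).card) * c y := by ring
        _ ≤ m * c y := by gcongr
  refine ⟨m, X, hX, c, hm0, hXm, fun x _ => hc0 x, ?_, hinst.isOptimal hX, ?_, ?_, ?_⟩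
  · intro v hv
    obtain ⟨x, -, rfl⟩ := mem_support_hardPrior.1 hv
    obtain ⟨l, hl⟩ := hc x
    refine ⟨isUnitDemand_hardValuation _ _, ?_⟩
    rw [hl]
    exact hasPrecision_hardValuation x (by omega)
  · obtain ⟨P, h1, h2, h3⟩ := hinst.exists_isIC_protocol hX
    refine ⟨P, h1, h2, h3.mono ?_⟩
    have : (3 : ℝ) ≤ n := by exact_mod_cast hn3
    push_cast
    nlinarith [Nat.cast_nonneg (α := ℝ) b]
  · obtain ⟨P, h1, h2⟩ := hinst.exists_short_protocol hX hc
    exact ⟨P, h1, h2.mono (log_bound hn3)⟩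
  · intro P hP hrev
    refine hinst.le_exAnteComm hX (fun x _ => hc1 x) hm0.ne' hW0 hb ?_ (fun h hh => ?_) hP hrev ?_
    · refine le_trans ?_ hsum
      have : (b / W : ℝ) ≤ (b + 1) / W - 1 / (4 * W) := by
        rw [div_sub_div _ _ hWpos.ne' (by positivity), div_le_div_iff₀ hWpos (by positivity)]
        nlinarith [mul_pos hWpos hWpos]
      gcongr
    · refine (hsur h hh).trans (le_of_eq ?_)
      congr 1
      have : (0 : ℝ) < m := by exact_mod_cast hm0
      push_cast
      field_simp
      norm_num
    -- The factor `2 * q` in `κ` converts the bound in `m` into one in `n`.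
    · have h1 : (n : ℝ≥0) ≤ 2 * q * m := by exact_mod_cast hnm
      have hq0 : (2 * q : ℝ≥0) ≠ 0 := by positivity
      calc 1 / (8 * (W : ℝ≥0)) / (2 * q) * n ≤ 1 / (8 * W) / (2 * q) * (2 * q * m) := by gcongr
        _ = 1 / (8 * W) * m := by
          rw [← mul_assoc, div_mul_cancel₀ _ hq0]
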